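/- Let $X$ and $Y$ be smooth irreducible complex projective surfaces, regarded as compact connected complex manifolds of dimension 2 that admit holomorphic embeddings in complex projective spaces. Let $U\subseteq X$ and $V\subseteq Y$ be big open subsets, i.e. the complements $X\setminus U$ and $Y\setminus V$ have codimension at least 2 (equivalently, they are finite sets), and let $g\colon U\to V$ be a biholomorphic map; for example, let $g\colon X\dashrightarrow Y$ be a birational map which restricts to an isomorphism $U\to V$. Then $X$ is a Higgs variety if and only if $Y$ is a Higgs variety. Here a Higgs bundle $\mathcal E=(E,\phi)$ on a smooth projective variety $X$ is a holomorphic vector bundle $E$ of rank $r\ge 1$ with a morphism $\phi\colon E\to E\otimes\Omega^1_X$ such that $\phi\wedge\phi=0$. For a morphism $f\colon C\to X$ from a smooth irreducible projective curve, $f^*\mathcal E$ is the bundle $f^*E$ with the Higgs field obtained by composing $f^*\phi$ with $f^*\Omega^1_X\to\Omega^1_C$. A Higgs bundle $(E,\phi)$ on $C$ is semistable if $\deg(F)/\operatorname{rk}(F)\le\deg(E)/\operatorname{rk}(E)$ for every coherent subsheaf $F\subset E$ with $0<\operatorname{rk}(F)<\operatorname{rk}(E)$ and $\phi(F)\subset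 F\otimes\Omega^1_C$. The variety $X$ is a Higgs variety if $\dim X=1$, or if every Higgs bundle $\mathcal E=(E,\phi)$ on $X$ such that $f^*\mathcal E$ is semistable for all morphisms $f\colon C\to X$ from smooth irreducible projective curves satisfies $$\Delta(E)=c_2(E)-\frac{r-1}{2r}\,c_1(E)^2=0\quad\text{in } H^4(X,\mathbb R).$$ -/

import Mathlib

open Bundle Module
open scoped Manifold ContDiff Topology LinearAlgebra.Projectivization

noncomputable section

namespace Higgs

/-! ### Smooth projective varieties

By the theorems of Chow and Serre a smooth (irreducible) complex projective variety is the same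
thing as a compact connected complex manifold which admits a holomorphic embedding in a complex
projective space; morphisms and (algebraic or holomorphic) vector bundles agree as well. -/

section Projective

variable {V : Type*} [NormedAddCommGroup V] [NormedSpace ℂ V]
  {X : Type*} [TopologicalSpace X] [ChartedSpace V X]

/-- `ι : X → ℙ^N` is a holomorphic injective immersion: near every point it is
`y ↦ [L y]` for a nowhere vanishing holomorphic map `L` to `ℂ^(N+1)`, and its
differential (with values in `ℂ^(N+1) / ℂ · L x`, the tangent space of `ℙ^N` at `[L x]`)
is injective. If `X` is compact, this is a closed embedding. -/
def IsProjectiveEmbedding (V : Type*) [NormedAddCommGroup V] [NormedSpace ℂ V]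
    {X : Type*} [TopologicalSpace X] [ChartedSpace V X]
    {N : ℕ} (ι : X → ℙ ℂ (EuclideanSpace ℂ (Fin (N + 1)))) : Prop :=
  Function.Injective ι ∧
  ∀ x : X, ∃ U : Set X, IsOpen U ∧ x ∈ U ∧ ∃ L : X → EuclideanSpace ℂ (Fin (N + 1)),
    ContMDiffOn 𝓘(ℂ, V) 𝓘(ℂ, EuclideanSpace ℂ (Fin (N + 1))) ω L U ∧
    (∀ y ∈ U, ∃ h : L y ≠ 0, ι y = Projectivization.mk ℂ (L y) h) ∧
    ∀ v : TangentSpace 𝓘(ℂ, V) x,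
      (mfderiv 𝓘(ℂ, V) 𝓘(ℂ, EuclideanSpace ℂ (Fin (N + 1))) L x v :
        EuclideanSpace ℂ (Fin (N + 1))) ∈ Submodule.span ℂ {L x} → v = 0

/-- A smooth complex projective variety, with tangent spaces modelled on `V`, as a
complex manifold. -/
structure IsSmoothProjectiveVariety (V : Type*) [NormedAddCommGroup V] [NormedSpace ℂ V]
    (X : Type*) [TopologicalSpace X] [ChartedSpace V X] : Prop where
  isManifold : IsManifold 𝓘(ℂ, V) ω X
  t2Space : T2Space X
  compactSpace : CompactSpace X
  connectedSpace : ConnectedSpace X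
  projective : ∃ (N : ℕ) (ι : X → ℙ ℂ (EuclideanSpace ℂ (Fin (N + 1)))),
    IsProjectiveEmbedding V ι

end Projective

/-- On a surface a Zariski open subset is big (its complement has codimension at least two)
if and only if its complement is finite. -/
def IsBigOpenInSurface {X : Type*} [TopologicalSpace X] (U : Set X) : Prop :=
  IsOpen U ∧ Uᶜ.Finite

/-! ### Holomorphic maps of bundles and Higgs fields -/

/-- The differential at `z` of the inverse of the preferred complex chart at `x`. -/
def chartInvDeriv {V : Type*} [NormedAddCommGroup V] [NormedSpace ℂ V]
    {X : Type*} [TopologicalSpace X] [ChartedSpace V X] (x : X) (z : V) :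
    V →L[ℂ] TangentSpace 𝓘(ℂ, V) ((extChartAt 𝓘(ℂ, V) x).symm z) :=
  mfderiv 𝓘(ℂ, V) 𝓘(ℂ, V) (extChartAt 𝓘(ℂ, V) x).symm z

section Bundles

variable (V : Type*) [NormedAddCommGroup V] [NormedSpace ℂ V]
  {X : Type*} [TopologicalSpace X] [ChartedSpace V X]
  (F : Type*) [NormedAddCommGroup F] [NormedSpace ℂ F]
  (E : X → Type*) [∀ x, AddCommMonoid (E x)] [∀ x, Module ℂ (E x)]
  [∀ x, TopologicalSpace (E x)] [TopologicalSpace (TotalSpace F E)] [FiberBundle F E]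
  (F' : Type*) [NormedAddCommGroup F'] [NormedSpace ℂ F']
  (E' : X → Type*) [∀ x, AddCommMonoid (E' x)] [∀ x, Module ℂ (E' x)]
  [∀ x, TopologicalSpace (E' x)] [TopologicalSpace (TotalSpace F' E')] [FiberBundle F' E']

/-- A family of linear maps `j x : E x → E' x` is holomorphic: in local trivializations and
charts it is given by a matrix of holomorphic functions. -/
def IsHolomorphicHom (j : ∀ x, E x →ₗ[ℂ] E' x) : Prop :=
  ∀ (x : X) (w : F), AnalyticAt ℂ
    (fun z : V =>
      let y := (extChartAt 𝓘(ℂ, V) x).symm z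
      (trivializationAt F' E' x
        (TotalSpace.mk' F' y (j y ((trivializationAt F E x).symm y w)))).2)
    (extChartAt 𝓘(ℂ, V) x x)

/-- A family `φ x : T_x X → End (E x)` is holomorphic, that is, it is a morphism of holomorphic
vector bundles `E → E ⊗ Ω¹`. -/
def IsHolomorphicEndForm (φ : ∀ x : X, TangentSpace 𝓘(ℂ, V) x →ₗ[ℂ] End ℂ (E x)) : Prop :=
  ∀ (x : X) (v : V) (w : F), AnalyticAt ℂ
    (fun z : V =>
      let y := (extChartAt 𝓘(ℂ, V) x).symm z
      (trivializationAt F E x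
        (TotalSpace.mk' F y
          (φ y (chartInvDeriv x z v) ((trivializationAt F E x).symm y w)))).2)
    (extChartAt 𝓘(ℂ, V) x x)

/-- A Higgs field on `E`: a holomorphic `φ : E → E ⊗ Ω¹` with `φ ∧ φ = 0`; the latter means that
the endomorphisms `φ(u)` and `φ(v)` commute for all tangent vectors `u`, `v`. -/
def IsHiggsField (φ : ∀ x : X, TangentSpace 𝓘(ℂ, V) x →ₗ[ℂ] End ℂ (E x)) : Prop :=
  IsHolomorphicEndForm V F E φ ∧
  ∀ (x : X) (u v : TangentSpace 𝓘(ℂ, V) x), φ x u * φ x v = φ x v * φ x u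

end Bundles

/-- The pullback of a Higgs field along `f : C → X`: compose `f^* φ : f^* E → f^* E ⊗ f^* Ω¹_X`
with `f^* Ω¹_X → Ω¹_C`. -/
def pullbackHiggs {V : Type*} [NormedAddCommGroup V] [NormedSpace ℂ V]
    {X : Type*} [TopologicalSpace X] [ChartedSpace V X]
    {W : Type*} [NormedAddCommGroup W] [NormedSpace ℂ W]
    {C : Type*} [TopologicalSpace C] [ChartedSpace W C]
    {E : X → Type*} [∀ x, AddCommMonoid (E x)] [∀ x, Module ℂ (E x)]
    (f : C → X) (φ : ∀ x : X, TangentSpace 𝓘(ℂ, V) x →ₗ[ℂ] End ℂ (E x)) :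
    ∀ c : C, TangentSpace 𝓘(ℂ, W) c →ₗ[ℂ] End ℂ ((f *ᵖ E) c) :=
  fun c => (φ (f c)).comp (mfderiv 𝓘(ℂ, W) 𝓘(ℂ, V) f c).toLinearMap

/-! ### Degree and semistability on a curve -/

section Curve

variable {C : Type*} [TopologicalSpace C] [ChartedSpace ℂ C]
  (r : ℕ) (E : C → Type*) [∀ x, AddCommMonoid (E x)] [∀ x, Module ℂ (E x)]
  [∀ x, TopologicalSpace (E x)] [TopologicalSpace (TotalSpace (EuclideanSpace ℂ (Fin r)) E)]
  [FiberBundle (EuclideanSpace ℂ (Fin r)) E]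

/-- The section `y ↦ s y` of `E` in the trivialization and the chart at `p`. -/
def localSection (s : ∀ y, E y) (p : C) (z : ℂ) : EuclideanSpace ℂ (Fin r) :=
  let y := (extChartAt 𝓘(ℂ) p).symm z
  (trivializationAt (EuclideanSpace ℂ (Fin r)) E p (TotalSpace.mk' _ y (s y))).2

/-- The section `s 0 ∧ … ∧ s (r - 1)` of `det E` in the trivialization and the chart at `p`. -/
def localDet (s : Fin r → ∀ y, E y) (p : C) (z : ℂ) : ℂ :=
  Matrix.det (Matrix.of fun i j => localSection r E (s j) p z i)

/-- `d` is the degree of the divisor of a nonzero meromorphic section `s 0 ∧ … ∧ s (r - 1)`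
of `det E`, where the `s i` are meromorphic sections of `E`. -/
def IsDegree (d : ℤ) : Prop :=
  ∃ s : Fin r → ∀ y, E y,
    (∀ p i, MeromorphicAt (localSection r E (s i) p) (extChartAt 𝓘(ℂ) p p)) ∧
    (∀ p, meromorphicOrderAt (localDet r E s p) (extChartAt 𝓘(ℂ) p p) ≠ ⊤) ∧
    d = ∑ᶠ p : C, (meromorphicOrderAt (localDet r E s p) (extChartAt 𝓘(ℂ) p p)).untop₀

open Classical in
/-- The degree of a holomorphic vector bundle on a compact Riemann surface, that is, the degree
of the divisor of any nonzero meromorphic section of its determinant. (Such sections always exist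
and the degree does not depend on their choice.) -/
def degree : ℤ :=
  if h : ∃ d, IsDegree r E d then h.choose else 0

/-- The slope `deg E / r`. -/
def slope : ℚ := degree r E / r

/-- Semistability of `(E, φ)` on a smooth projective curve. A nonzero coherent subsheaf of smaller
rank of the sheaf of sections of `E` is the same thing as a holomorphic vector bundle `G` together
with a morphism `j : G → E` which is injective as a map of sheaves, i.e. injective on the fibres
over a dense set of points. It is `φ`-invariant if `φ ∘ j = (j ⊗ 1) ∘ ψ` for a morphism
`ψ : G → G ⊗ Ω¹`. -/
def IsSemistableOnCurve (φ : ∀ x : C, TangentSpace 𝓘(ℂ) x →ₗ[ℂ] End ℂ (E x)) : Prop :=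
  ∀ (s : ℕ), 0 < s → s < r →
  ∀ (G : C → Type) [∀ x, AddCommMonoid (G x)] [∀ x, Module ℂ (G x)]
    [∀ x, TopologicalSpace (G x)] [TopologicalSpace (TotalSpace (EuclideanSpace ℂ (Fin s)) G)]
    [FiberBundle (EuclideanSpace ℂ (Fin s)) G] [VectorBundle ℂ (EuclideanSpace ℂ (Fin s)) G]
    [ContMDiffVectorBundle ω (EuclideanSpace ℂ (Fin s)) G 𝓘(ℂ)]
    (j : ∀ x, G x →ₗ[ℂ] E x) (ψ : ∀ x : C, TangentSpace 𝓘(ℂ) x →ₗ[ℂ] End ℂ (G x)),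
    IsHolomorphicHom ℂ (EuclideanSpace ℂ (Fin s)) G (EuclideanSpace ℂ (Fin r)) E j →
    Dense {x | Function.Injective (j x)} →
    IsHolomorphicEndForm ℂ (EuclideanSpace ℂ (Fin s)) G ψ →
    (∀ x (v : TangentSpace 𝓘(ℂ) x) (w : G x), φ x v (j x w) = j x (ψ x v w)) →
    slope s G ≤ slope r E

end Curve

/-! ### Differential forms on a manifold -/

section Forms

variable {V : Type*} [NormedAddCommGroup V] [NormedSpace ℂ V]
  {X : Type*} [TopologicalSpace X] [ChartedSpace V X]

/-- The differential over `ℝ` at `z` of the inverse of the preferred chart at `x`. -/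
def chartInvDerivReal (x : X) (z : V) : V →L[ℝ] V :=
  mfderiv 𝓘(ℝ, V) 𝓘(ℝ, V) (extChartAt 𝓘(ℝ, V) x).symm z

/-- A complex valued `k`-form `η` on `X` (recall that the tangent space at each point is a copy
of `V`) in the preferred chart at `x`. -/
def formInChart {k : ℕ} (η : X → V [⋀^Fin k]→L[ℝ] ℂ) (x : X) (z : V) : V [⋀^Fin k]→L[ℝ] ℂ :=
  (η ((extChartAt 𝓘(ℝ, V) x).symm z)).compContinuousLinearMap (chartInvDerivReal x z)

/-- `η` is a smooth `k`-form. -/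
def IsSmoothForm {k : ℕ} (η : X → V [⋀^Fin k]→L[ℝ] ℂ) : Prop :=
  ∀ x, ContDiffAt ℝ ∞ (formInChart η x) (extChartAt 𝓘(ℝ, V) x x)

/-- The exterior derivative of a form, at each point computed in the preferred chart there. -/
def formDeriv {k : ℕ} (η : X → V [⋀^Fin k]→L[ℝ] ℂ) (x : X) : V [⋀^Fin (k + 1)]→L[ℝ] ℂ :=
  extDeriv (formInChart η x) (extChartAt 𝓘(ℝ, V) x x)

/-- The exterior product of two 2-forms with values in a ring, evaluated on four vectors. -/
def wedgeTwoTwo {A : Type*} [Ring A] (α β : V → V → A) (v : Fin 4 → V) : A :=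
  α (v 0) (v 1) * β (v 2) (v 3) - α (v 0) (v 2) * β (v 1) (v 3) + α (v 0) (v 3) * β (v 1) (v 2)
    + α (v 1) (v 2) * β (v 0) (v 3) - α (v 1) (v 3) * β (v 0) (v 2) + α (v 2) (v 3) * β (v 0) (v 1)

end Forms

/-! ### Chern forms and the discriminant -/

section Chern

variable {V : Type*} [NormedAddCommGroup V] [NormedSpace ℂ V]
  {X : Type*} [TopologicalSpace X] [ChartedSpace V X]
  {r : ℕ} {E : X → Type*} [∀ x, AddCommMonoid (E x)] [∀ x, Module ℂ (E x)]
  [∀ x, TopologicalSpace (E x)] [TopologicalSpace (TotalSpace (EuclideanSpace ℂ (Fin r)) E)]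
  [FiberBundle (EuclideanSpace ℂ (Fin r)) E] [VectorBundle ℂ (EuclideanSpace ℂ (Fin r)) E]

/-- The transition function of `E` from the trivialization at `b'` to the trivialization at `b`. -/
def transition (r : ℕ) (E : X → Type*) [∀ x, AddCommMonoid (E x)] [∀ x, Module ℂ (E x)]
    [∀ x, TopologicalSpace (E x)] [TopologicalSpace (TotalSpace (EuclideanSpace ℂ (Fin r)) E)]
    [FiberBundle (EuclideanSpace ℂ (Fin r)) E] [VectorBundle ℂ (EuclideanSpace ℂ (Fin r)) E]
    (b' b x : X) : EuclideanSpace ℂ (Fin r) →L[ℂ] EuclideanSpace ℂ (Fin r) :=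
  ((trivializationAt (EuclideanSpace ℂ (Fin r)) E b').coordChangeL ℂ
    (trivializationAt (EuclideanSpace ℂ (Fin r)) E b) x).toContinuousLinearMap

/-- A matrix valued 1-form on `X` in the preferred chart at `x`. -/
def endFormInChart (a : X → V →L[ℝ] (EuclideanSpace ℂ (Fin r) →L[ℂ] EuclideanSpace ℂ (Fin r)))
    (x : X) (z : V) : V →L[ℝ] (EuclideanSpace ℂ (Fin r) →L[ℂ] EuclideanSpace ℂ (Fin r)) :=
  (a ((extChartAt 𝓘(ℝ, V) x).symm z)).comp (chartInvDerivReal x z)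

variable (V r E) in
/-- A smooth complex linear connection on the vector bundle `E`. In the trivialization at `b` the
covariant derivative of a section `s` is `d s + (form b) s`. -/
structure Connection where
  form : X → X → V →L[ℝ] (EuclideanSpace ℂ (Fin r) →L[ℂ] EuclideanSpace ℂ (Fin r))
  smooth : ∀ b, ∀ x ∈ (trivializationAt (EuclideanSpace ℂ (Fin r)) E b).baseSet,
    ContDiffAt ℝ ∞ (endFormInChart (form b) x) (extChartAt 𝓘(ℝ, V) x x)
  transform : ∀ b b', ∀ x ∈ (trivializationAt (EuclideanSpace ℂ (Fin r)) E b).baseSet,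
    x ∈ (trivializationAt (EuclideanSpace ℂ (Fin r)) E b').baseSet → ∀ v : V,
    transition r E b' b x * form b' x v = form b x v * transition r E b' b x +
      (show EuclideanSpace ℂ (Fin r) →L[ℂ] EuclideanSpace ℂ (Fin r) from
        mfderiv 𝓘(ℝ, V) 𝓘(ℝ, EuclideanSpace ℂ (Fin r) →L[ℂ] EuclideanSpace ℂ (Fin r))
          (transition r E b' b) x v)

/-- The curvature `dA + A ∧ A` of a connection at the point `x`, in the trivialization and the
chart at `x`. -/
def Connection.curvature (D : Connection V r E) (x : X) (u v : V) :
    EuclideanSpace ℂ (Fin r) →L[ℂ] EuclideanSpace ℂ (Fin r) :=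
  let a := endFormInChart (D.form x) x
  let z := extChartAt 𝓘(ℝ, V) x x
  fderiv ℝ a z u v - fderiv ℝ a z v u + (a z u * a z v - a z v * a z u)

/-- The trace of an endomorphism of `ℂ^r`. -/
def tr {r : ℕ} (T : EuclideanSpace ℂ (Fin r) →L[ℂ] EuclideanSpace ℂ (Fin r)) : ℂ :=
  LinearMap.trace ℂ (EuclideanSpace ℂ (Fin r)) T.toLinearMap

/-- The first Chern form `(i / 2π) tr Θ`, where `Θ` is the curvature. -/
def Connection.chernFormOne (D : Connection V r E) (x : X) (u v : V) : ℂ :=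
  Complex.I / (2 * Real.pi) * tr (D.curvature x u v)

/-- The second Chern form, the degree two part `(tr (Θ ∧ Θ) - tr Θ ∧ tr Θ) / 8π²` of
`det (1 + (i / 2π) Θ)`. -/
def Connection.chernFormTwo (D : Connection V r E) (x : X) (v : Fin 4 → V) : ℂ :=
  1 / (8 * Real.pi ^ 2) *
    (tr (wedgeTwoTwo (D.curvature x) (D.curvature x) v) -
      wedgeTwoTwo (fun u w => tr (D.curvature x u w)) (fun u w => tr (D.curvature x u w)) v)

/-- The closed 4-form `c₂ - (r - 1) / (2 r) · c₁ ∧ c₁`, which represents the discriminant `Δ(E)` in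
de Rham cohomology. -/
def Connection.discriminantForm (D : Connection V r E) (x : X) (v : Fin 4 → V) : ℂ :=
  D.chernFormTwo x v -
    ((r : ℂ) - 1) / (2 * r) * wedgeTwoTwo (D.chernFormOne x) (D.chernFormOne x) v

variable (V r E) in
/-- `Δ(E) = 0` in the fourth de Rham cohomology of `X`: the discriminant form of a connection is
exact. (Connections exist, and the class of the form does not depend on the connection. It is a
real class, so that its vanishing in real and in complex cohomology is the same.) -/
def DiscriminantVanishes : Prop :=
  ∃ (D : Connection V r E) (η : X → V [⋀^Fin 3]→L[ℝ] ℂ), IsSmoothForm η ∧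
    ∀ (x : X) (v : Fin 4 → V), formDeriv η x v = D.discriminantForm x v

end Chern

/-! ### Higgs varieties -/

/-- A smooth projective variety `X` is a Higgs variety if it is a curve, or if `Δ(E) = 0`
for every Higgs bundle `(E, φ)` on `X` all of whose pullbacks along morphisms `f : C → X` from
smooth projective curves (that is, compact connected Riemann surfaces) are semistable. -/
def IsHiggsVariety (V : Type*) [NormedAddCommGroup V] [NormedSpace ℂ V]
    (X : Type*) [TopologicalSpace X] [ChartedSpace V X] : Prop :=
  finrank ℂ V = 1 ∨
  ∀ (r : ℕ), 0 < r →
  ∀ (E : X → Type) [∀ x, AddCommMonoid (E x)] [∀ x, Module ℂ (E x)]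
    [∀ x, TopologicalSpace (E x)] [TopologicalSpace (TotalSpace (EuclideanSpace ℂ (Fin r)) E)]
    [FiberBundle (EuclideanSpace ℂ (Fin r)) E] [VectorBundle ℂ (EuclideanSpace ℂ (Fin r)) E]
    [ContMDiffVectorBundle ω (EuclideanSpace ℂ (Fin r)) E 𝓘(ℂ, V)]
    (φ : ∀ x : X, TangentSpace 𝓘(ℂ, V) x →ₗ[ℂ] End ℂ (E x)),
    IsHiggsField V (EuclideanSpace ℂ (Fin r)) E φ →
    (∀ (C : Type) [TopologicalSpace C] [ChartedSpace ℂ C] [IsManifold 𝓘(ℂ) ω C]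
      [T2Space C] [CompactSpace C] [ConnectedSpace C] (f : C^ω⟮𝓘(ℂ), C; 𝓘(ℂ, V), X⟯),
      IsSemistableOnCurve r ((f : C → X) *ᵖ E) (pullbackHiggs f φ)) →
    DiscriminantVanishes V r E

end Higgs

end

/-! A biholomorphic map between complements of finite sets in compact complex surfaces extends to a
biholomorphic map of the surfaces, and being a Higgs variety is a biholomorphic invariant.

Extension (`exists_diffeomorph_of_finite_compl`). Near a missing point of `X` the values of `g`
leave every compact subset of `g.target`, hence approach the finite set `g.targetᶜ`. A punctured
ball of real dimension at least two is connected, so they approach a single point, and `g` extends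
continuously (`exists_tendsto_of_finite_compl`). A continuous function of two complex variables,
holomorphic off a point, is holomorphic by a double Cauchy integral
(`analyticAt_of_separately_differentiable`). The same applies to `g.symm`, and the two extensions
are inverse to each other by density.

Invariance (`IsHiggsVariety.of_diffeomorph`). Given a biholomorphic `f : X → Y`, a Higgs bundle on
`Y` pulls back to `X`. Its restrictions to curves in `X` are restrictions of the original bundle
along composites with `f`, so they stay semistable. If the discriminant vanishes on `X`, a
connection on the pullback and a primitive of its discriminant form are transported to `Y` along the
inverse of `f` (`DiscriminantVanishes.of_pullback`). -/

/-! ### Removable points for holomorphic functions of two variables -/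

section Osgood

open scoped BoundedContinuousFunction

variable {F : Type*} [NormedAddCommGroup F] [NormedSpace ℂ F]

/-- Integration over the square `[0, 2π]²` against a continuous function, as a continuous linear
functional on bounded continuous functions. -/
theorem exists_clm_eq_iterated_integral {G : ℝ × ℝ → F} (hG : Continuous G) :
    ∃ L : (ℝ × ℝ →ᵇ ℂ) →L[ℂ] F, ∀ a : ℝ × ℝ →ᵇ ℂ,
      L a = ∫ s in (0 : ℝ)..2 * Real.pi, ∫ t in (0 : ℝ)..2 * Real.pi, a (s, t) • G (s, t) := by
  have hc : ∀ a : ℝ × ℝ →ᵇ ℂ, Continuous fun p : ℝ × ℝ => a p • G p := fun a =>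
    a.continuous.smul hG
  have hc1 : ∀ (a : ℝ × ℝ →ᵇ ℂ) (s : ℝ), Continuous fun t : ℝ => a (s, t) • G (s, t) :=
    fun a s => (hc a).comp (by fun_prop)
  have hc2 : ∀ a : ℝ × ℝ →ᵇ ℂ, Continuous fun s : ℝ =>
      ∫ t in (0 : ℝ)..2 * Real.pi, a (s, t) • G (s, t) := fun a =>
    intervalIntegral.continuous_parametric_intervalIntegral_of_continuous' (hc a) _ _
  obtain ⟨M, hM⟩ : ∃ M, ∀ p ∈ Set.Icc (0 : ℝ) (2 * Real.pi) ×ˢ Set.Icc (0 : ℝ) (2 * Real.pi),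
      ‖G p‖ ≤ M := (isCompact_Icc.prod isCompact_Icc).exists_bound_of_continuousOn hG.continuousOn
  have hpi : (0 : ℝ) ≤ 2 * Real.pi := by positivity
  refine ⟨LinearMap.mkContinuous
    { toFun := fun a => ∫ s in (0 : ℝ)..2 * Real.pi, ∫ t in (0 : ℝ)..2 * Real.pi,
        a (s, t) • G (s, t)
      map_add' := fun a b => ?_
      map_smul' := fun c a => ?_ } (M * |2 * Real.pi - 0| * |2 * Real.pi - 0|) fun a => ?_,
    fun a => rfl⟩
  · rw [← intervalIntegral.integral_add ((hc2 a).intervalIntegrable _ _)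
      ((hc2 b).intervalIntegrable _ _)]
    congr 1 with s
    rw [← intervalIntegral.integral_add ((hc1 a s).intervalIntegrable _ _)
      ((hc1 b s).intervalIntegrable _ _)]
    simp [add_smul]
  · rw [RingHom.id_apply, ← intervalIntegral.integral_smul]
    congr 1 with s
    rw [← intervalIntegral.integral_smul]
    simp [smul_smul]
  · have key : ‖∫ s in (0 : ℝ)..2 * Real.pi, ∫ t in (0 : ℝ)..2 * Real.pi, a (s, t) • G (s, t)‖ ≤
        (‖a‖ * M * |2 * Real.pi - 0|) * |2 * Real.pi - 0| := by
      refine intervalIntegral.norm_integral_le_of_norm_le_const fun s hs => ?_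
      refine intervalIntegral.norm_integral_le_of_norm_le_const fun t ht => ?_
      rw [Set.uIoc_of_le hpi] at hs ht
      rw [norm_smul]
      exact mul_le_mul (a.norm_coe_le_norm _)
        (hM (s, t) ⟨Set.Ioc_subset_Icc_self hs, Set.Ioc_subset_Icc_self ht⟩)
        (norm_nonneg _) (norm_nonneg _)
    refine key.trans (le_of_eq ?_)
    ring

/-- The Cauchy kernel depends analytically on the parameter, as a bounded function on the
circle. -/
theorem exists_analyticAt_cauchyKernel (c : ℂ) {R : ℝ} (hR : 0 < R) (p : C(ℝ × ℝ, ℝ)) :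
    ∃ k : ℂ → (ℝ × ℝ →ᵇ ℂ), AnalyticAt ℂ k c ∧
      ∀ᶠ z in 𝓝 c, ∀ t, k z t = (circleMap c R (p t) - z)⁻¹ := by
  have hcirc : Continuous fun t => circleMap c R (p t) :=
    (continuous_circleMap c R).comp p.continuous
  have hne : ∀ t, circleMap c R (p t) - c ≠ 0 := fun t => by
    exact sub_ne_zero.2 (circleMap_ne_center hR.ne')
  have hnorm : ∀ t, ‖circleMap c R (p t) - c‖ = R := fun t => by
    simp [circleMap, abs_of_pos hR]
  -- The denominator at `z = c` has constant modulus `R`, so it is a unit of the Banach algebra of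
  -- bounded continuous functions. For general `z` it is affine in `z`, and inversion is analytic at
  -- units.
  let u : ℝ × ℝ →ᵇ ℂ := BoundedContinuousFunction.ofNormedAddCommGroup
    (fun t => circleMap c R (p t) - c) (by fun_prop) R fun t => (hnorm t).le
  let v : ℝ × ℝ →ᵇ ℂ := BoundedContinuousFunction.ofNormedAddCommGroup
    (fun t => (circleMap c R (p t) - c)⁻¹) ((hcirc.sub continuous_const).inv₀ hne) R⁻¹
    fun t => by rw [norm_inv, hnorm t]
  have huv : u * v = 1 := by
    ext t
    exact mul_inv_cancel₀ (hne t)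
  let U : (ℝ × ℝ →ᵇ ℂ)ˣ := ⟨u, v, huv, by rw [mul_comm, huv]⟩
  let h : ℂ → (ℝ × ℝ →ᵇ ℂ) := fun z => u - (z - c) • 1
  have hh : AnalyticAt ℂ h c := by
    have : AnalyticAt ℂ (fun z : ℂ => z - c) c := analyticAt_id.sub analyticAt_const
    exact analyticAt_const.sub (this.smul analyticAt_const)
  have hhc : h c = (U : ℝ × ℝ →ᵇ ℂ) := by simp [h, U]
  refine ⟨fun z => Ring.inverse (h z), ?_, ?_⟩
  · refine AnalyticAt.fun_comp (g := Ring.inverse) ?_ hh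
    rw [hhc]
    exact analyticAt_inverse U
  · have hU : ∀ᶠ z in 𝓝 c, IsUnit (h z) :=
      hh.continuousAt.eventually (by rw [hhc]; exact Units.isOpen.mem_nhds U.isUnit)
    filter_upwards [hU] with z hz t
    have h1 := congrArg (fun a : ℝ × ℝ →ᵇ ℂ => a t) (Ring.inverse_mul_cancel _ hz)
    have h2 : h z t = circleMap c R (p t) - z := by
      simp only [h, u, BoundedContinuousFunction.coe_sub, BoundedContinuousFunction.coe_smul,
        BoundedContinuousFunction.coe_ofNormedAddCommGroup, Pi.sub_apply,
        BoundedContinuousFunction.coe_one, Pi.one_apply, smul_eq_mul]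
      ring
    simp only [BoundedContinuousFunction.coe_mul, Pi.mul_apply, h2,
      BoundedContinuousFunction.coe_one, Pi.one_apply] at h1
    exact eq_inv_of_mul_eq_one_left h1

variable [CompleteSpace F]

/-- **Osgood's lemma**, with an exceptional set: a continuous function of two complex variables is
analytic if it is holomorphic in each variable, up to countably many points on each line in the
first direction and for first coordinate on a circle only in the second. -/
theorem analyticAt_of_separately_differentiable {f : ℂ × ℂ → F} {c : ℂ × ℂ} {R : ℝ} (hR : 0 < R)
    (hf : ContinuousOn f (Metric.closedBall c.1 R ×ˢ Metric.closedBall c.2 R)) {S : Set ℂ}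
    (hS : S.Countable)
    (h1 : ∀ z ∈ Metric.ball c.1 R \ S, ∀ w ∈ Metric.ball c.2 R,
      DifferentiableAt ℂ (fun z' => f (z', w)) z)
    (h2 : ∀ z ∈ Metric.sphere c.1 R, ∀ w ∈ Metric.ball c.2 R,
      DifferentiableAt ℂ (fun w' => f (z, w')) w) :
    AnalyticAt ℂ f c := by
  -- Everything in the double Cauchy integral that does not depend on `z`: the boundary values of
  -- `f` and the derivatives of the two circle parametrizations.
  let G : ℝ × ℝ → F := fun p => (deriv (circleMap c.1 R) p.1 * deriv (circleMap c.2 R) p.2) •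
    f (circleMap c.1 R p.1, circleMap c.2 R p.2)
  have hG : Continuous G := by
    refine Continuous.smul (by simp only [deriv_circleMap]; fun_prop)
      (hf.comp_continuous (by fun_prop) fun p => ⟨?_, ?_⟩)
    · exact circleMap_mem_closedBall _ hR.le _
    · exact circleMap_mem_closedBall _ hR.le _
  obtain ⟨L, hL⟩ := exists_clm_eq_iterated_integral hG
  obtain ⟨k1, hk1, hk1'⟩ := exists_analyticAt_cauchyKernel c.1 hR ⟨Prod.fst, continuous_fst⟩
  obtain ⟨k2, hk2, hk2'⟩ := exists_analyticAt_cauchyKernel c.2 hR ⟨Prod.snd, continuous_snd⟩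
  have hfst : AnalyticAt ℂ (fun z : ℂ × ℂ => k1 z.1) c := hk1.fun_comp analyticAt_fst
  have hsnd : AnalyticAt ℂ (fun z : ℂ × ℂ => k2 z.2) c := hk2.fun_comp analyticAt_snd
  -- Joint analyticity comes from applying the bounded functional `L` to a product of analytic
  -- kernels.
  have hmain : AnalyticAt ℂ (fun z : ℂ × ℂ =>
      (2 * Real.pi * Complex.I : ℂ)⁻¹ • (2 * Real.pi * Complex.I : ℂ)⁻¹ •
        L (k1 z.1 * k2 z.2)) c :=
    (((L.analyticAt _).fun_comp (hfst.mul hsnd)).const_smul).const_smul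
  refine hmain.congr ?_
  have e1 : ∀ᶠ z : ℂ × ℂ in 𝓝 c, ∀ t, k1 z.1 t = (circleMap c.1 R t.1 - z.1)⁻¹ :=
    continuous_fst.continuousAt.eventually hk1'
  have e2 : ∀ᶠ z : ℂ × ℂ in 𝓝 c, ∀ t, k2 z.2 t = (circleMap c.2 R t.2 - z.2)⁻¹ :=
    continuous_snd.continuousAt.eventually hk2'
  have e3 : ∀ᶠ z : ℂ × ℂ in 𝓝 c, z.1 ∈ Metric.ball c.1 R :=
    continuous_fst.continuousAt.eventually (Metric.ball_mem_nhds _ hR)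
  have e4 : ∀ᶠ z : ℂ × ℂ in 𝓝 c, z.2 ∈ Metric.ball c.2 R :=
    continuous_snd.continuousAt.eventually (Metric.ball_mem_nhds _ hR)
  filter_upwards [e1, e2, e3, e4] with z hz1 hz2 hz3 hz4
  -- Cauchy's formula in the first variable tolerates the countable set `S`. In the second variable
  -- it is applied only where the first lies on the circle of integration.
  have A1 := Complex.two_pi_I_inv_smul_circleIntegral_sub_inv_smul_of_differentiable_on_off_countable
    (f := fun z' => f (z', z.2)) hS hz3
    (hf.comp (by fun_prop) fun z' hz' => ⟨hz', Metric.ball_subset_closedBall hz4⟩)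
    (fun x hx => h1 x hx z.2 hz4)
  have A2 : ∀ s : ℝ, _ := fun s =>
    Complex.two_pi_I_inv_smul_circleIntegral_sub_inv_smul_of_differentiable_on_off_countable
    (f := fun w => f (circleMap c.1 R s, w)) Set.countable_empty hz4
    (hf.comp (by fun_prop) fun w hw => ⟨circleMap_mem_closedBall _ hR.le _, hw⟩)
    (fun x hx => h2 _ (circleMap_mem_sphere _ hR.le _) x hx.1)
  refine Eq.trans ?_ A1
  congr 1
  simp only [circleIntegral, ← A2]
  rw [hL, ← intervalIntegral.integral_smul]
  congr 1 with s
  simp only [← intervalIntegral.integral_smul]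
  congr 1 with t
  simp only [BoundedContinuousFunction.coe_mul, Pi.mul_apply, hz1, hz2, G, smul_smul]
  congr 1
  ring

/-- With `S = {c.1}`, horizontal lines are tested only away from the first coordinate of `c`;
vertical lines over the circle of radius `R > 0` about `c.1` miss `c` altogether. -/
theorem analyticAt_prod_of_differentiableAt_punctured {f : ℂ × ℂ → F} {c : ℂ × ℂ}
    (hf : ∀ᶠ z in 𝓝 c, ContinuousAt f z) (hd : ∀ᶠ z in 𝓝 c, z ≠ c → DifferentiableAt ℂ f z) :
    AnalyticAt ℂ f c := by
  obtain ⟨R, hR, hball⟩ := Metric.nhds_basis_closedBall.eventually_iff.1 (hf.and hd)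
  rw [← closedBall_prod_same] at hball
  refine analyticAt_of_separately_differentiable hR
    (fun z hz => (hball hz).1.continuousWithinAt) (Set.countable_singleton c.1) ?_ ?_
  · rintro z ⟨hz, hzc⟩ w hw
    have := (hball (x := (z, w)) ⟨Metric.ball_subset_closedBall hz,
      Metric.ball_subset_closedBall hw⟩).2 fun h => hzc (congrArg Prod.fst h)
    exact this.comp z (f := fun z' : ℂ => (z', w)) (by fun_prop)
  · intro z hz w hw
    have := (hball (x := (z, w)) ⟨Metric.sphere_subset_closedBall hz,
      Metric.ball_subset_closedBall hw⟩).2 fun h =>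
        Metric.ne_of_mem_sphere hz hR.ne' (congrArg Prod.fst h)
    exact this.comp w (f := fun w' : ℂ => (z, w')) (by fun_prop)

/-- A continuous function on an open subset of `ℂ²` which is holomorphic off a point is
holomorphic. -/
theorem analyticAt_of_differentiableAt_punctured {f : EuclideanSpace ℂ (Fin 2) → F}
    {c : EuclideanSpace ℂ (Fin 2)} (hf : ∀ᶠ z in 𝓝 c, ContinuousAt f z)
    (hd : ∀ᶠ z in 𝓝 c, z ≠ c → DifferentiableAt ℂ f z) : AnalyticAt ℂ f c := by
  let e : EuclideanSpace ℂ (Fin 2) ≃L[ℂ] ℂ × ℂ :=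
    (EuclideanSpace.equiv (Fin 2) ℂ).trans (ContinuousLinearEquiv.finTwoArrow ℂ ℂ)
  have hc : Filter.Tendsto e.symm (𝓝 (e c)) (𝓝 c) := by
    simpa using e.symm.continuous.tendsto (e c)
  have key : AnalyticAt ℂ (f ∘ e.symm) (e c) := by
    refine analyticAt_prod_of_differentiableAt_punctured ?_ ?_
    · filter_upwards [hc.eventually hf] with z hz
      exact hz.comp e.symm.continuous.continuousAt
    · filter_upwards [hc.eventually hd] with z hz hzc
      exact (hz fun h => hzc (by rw [← h, e.apply_symm_apply])).comp z
        e.symm.differentiableAt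
  refine (key.fun_comp (e.toContinuousLinearMap.analyticAt c)).congr (.of_forall fun z => ?_)
  simp

end Osgood

/-! ### Extension of maps over finite sets -/

section Extension

open Filter Set

/-- `univBall` carries the complement of the origin, connected in real dimension at least two, onto
the punctured ball. -/
theorem isPreconnected_ball_diff_center {V : Type*} [NormedAddCommGroup V] [NormedSpace ℝ V]
    (hV : 1 < Module.rank ℝ V) (c : V) {r : ℝ} (hr : 0 < r) :
    IsPreconnected (Metric.ball c r \ {c}) := by
  have himage : OpenPartialHomeomorph.univBall c r '' {0}ᶜ = Metric.ball c r \ {c} := by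
    have hinj : InjOn (OpenPartialHomeomorph.univBall c r) univ := by
      simpa using (OpenPartialHomeomorph.univBall c r).injOn
    rw [compl_eq_univ_sdiff, (hinj.image_sdiff (t := {0})), univ_inter, image_singleton,
      OpenPartialHomeomorph.univBall_apply_zero, ← OpenPartialHomeomorph.univBall_target c hr,
      ← (OpenPartialHomeomorph.univBall c r).image_source_eq_target,
      OpenPartialHomeomorph.univBall_source]
  rw [← himage]
  exact (isConnected_compl_singleton_of_one_lt_rank hV 0).isPreconnected.image _
    (OpenPartialHomeomorph.continuous_univBall c r).continuousOn

variable {V : Type*} [NormedAddCommGroup V] [NormedSpace ℝ V]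
  {X : Type*} [TopologicalSpace X] [ChartedSpace V X]
  {Y : Type*} [TopologicalSpace Y]

/-- Small chart balls serve as neighbourhoods that stay connected when punctured; this is what
forces the limit at a missing point to be unique. -/
theorem exists_nhds_isPreconnected_diff_singleton (hV : 1 < Module.rank ℝ V) {x : X} {N : Set X}
    (hN : N ∈ 𝓝 x) : ∃ B ∈ 𝓝 x, B ⊆ N ∧ IsPreconnected (B \ {x}) := by
  let e := chartAt V x
  have hx : x ∈ e.source := mem_chart_source V x
  have htend : Tendsto e.symm (𝓝 (e x)) (𝓝 x) := e.tendsto_symm hx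
  obtain ⟨r, hr, hball⟩ := Metric.nhds_basis_ball.mem_iff.1
    (inter_mem (e.open_target.mem_nhds (e.map_source hx)) (htend hN))
  refine ⟨e.symm '' Metric.ball (e x) r, ?_, ?_, ?_⟩
  · have := e.symm.image_mem_nhds (e.map_source hx) (Metric.ball_mem_nhds (e x) hr)
    rwa [e.left_inv hx] at this
  · rintro _ ⟨z, hz, rfl⟩
    exact (hball hz).2
  · have hinj : InjOn e.symm (Metric.ball (e x) r) :=
      e.symm.injOn.mono fun z hz => (hball hz).1
    have : e.symm '' Metric.ball (e x) r \ {x} = e.symm '' (Metric.ball (e x) r \ {e x}) := by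
      rw [hinj.image_sdiff, inter_eq_right.2 (singleton_subset_iff.2 (Metric.mem_ball_self hr)),
        image_singleton, e.left_inv hx]
    rw [this]
    exact (isPreconnected_ball_diff_center hV _ hr).image _
      (e.continuousOn_symm.mono fun z hz => (hball hz.1).1)

/-- Charts show that no point is isolated, and removing finitely many non-isolated points leaves a
dense set. -/
theorem dense_of_finite_compl [T1Space X] [hV : Nontrivial V] {S : Set X} (hS : Sᶜ.Finite) :
    Dense S := by
  have hbot : ∀ x : X, (𝓝[≠] x).NeBot := fun x => by
    let e := chartAt V x
    have hx : x ∈ e.source := mem_chart_source V x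
    have : (𝓝[≠] (e x)).NeBot := Module.punctured_nhds_neBot ℝ V (e x)
    have htend : Tendsto e.symm (𝓝[≠] (e x)) (𝓝[≠] x) := by
      refine tendsto_nhdsWithin_iff.2 ⟨(e.tendsto_symm hx).mono_left nhdsWithin_le_nhds, ?_⟩
      have h1 : ∀ᶠ z in 𝓝[≠] (e x), z ∈ e.target :=
        nhdsWithin_le_nhds (e.open_target.mem_nhds (e.map_source hx))
      filter_upwards [h1, self_mem_nhdsWithin] with z hz hne h
      exact hne (by rw [← e.right_inv hz, mem_singleton_iff.1 h]; rfl)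
    exact htend.neBot
  have := (dense_univ (X := X)).sdiff_finite hS
  simpa [sdiff_eq] using this

/-- A homeomorphism between complements of finite sets in compact manifolds of dimension at least
two has a limit at every point. -/
theorem exists_tendsto_of_finite_compl [T2Space X] [T2Space Y] [CompactSpace Y]
    (hV : 1 < Module.rank ℝ V) (g : OpenPartialHomeomorph X Y) (hs : g.sourceᶜ.Finite)
    (ht : g.targetᶜ.Finite) (x : X) : ∃ y, Tendsto g (𝓝[g.source] x) (𝓝 y) := by
  by_cases hx : x ∈ g.source
  · exact ⟨g x, (g.continuousAt hx).tendsto.mono_left nhdsWithin_le_nhds⟩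
  have : Nontrivial V := by
    by_contra h
    rw [not_nontrivial_iff_subsingleton] at h
    rw [rank_subsingleton'] at hV
    exact absurd hV (by simp)
  have hdense : Dense g.source := dense_of_finite_compl (V := V) hs
  -- Properness: `Wᶜ` is a compact subset of `g.target`, so its preimage is compact, hence closed,
  -- and it misses `x` because `x` is outside `g.source`.
  have hclust : ∀ W : Set Y, IsOpen W → g.targetᶜ ⊆ W →
      ∀ᶠ z in 𝓝 x, z ∈ g.source → g z ∈ W := by
    intro W hW hsub
    have hsub' : Wᶜ ⊆ g.target := compl_subset_comm.1 hsub
    have hK : IsCompact (g.symm '' Wᶜ) :=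
      hW.isClosed_compl.isCompact.image_of_continuousOn (g.continuousOn_symm.mono hsub')
    have hxK : x ∉ g.symm '' Wᶜ := by
      rintro ⟨y, hy, rfl⟩
      exact hx (g.map_target (hsub' hy))
    filter_upwards [hK.isClosed.isOpen_compl.mem_nhds hxK] with z hz hzs
    by_contra hgz
    exact hz ⟨g z, hgz, g.left_inv hzs⟩
  obtain ⟨O, hO, hdisj⟩ := ht.t2_separation
  have hW : IsOpen (⋃ y ∈ g.targetᶜ, O y) := isOpen_biUnion fun y _ => (hO y).2
  have h1 := hclust _ hW fun y hy => mem_biUnion hy (hO y).1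
  have h2 : ∀ᶠ z in 𝓝 x, z ≠ x → z ∈ g.source := by
    have hfin : (g.sourceᶜ \ {x}).Finite := hs.subset sdiff_subset
    filter_upwards [hfin.isClosed.isOpen_compl.mem_nhds (fun h => h.2 rfl)] with z hz hne
    by_contra h
    exact hz ⟨h, hne⟩
  obtain ⟨B, hB, hBsub, hBconn⟩ := exists_nhds_isPreconnected_diff_singleton hV (h1.and h2)
  have hBs : B \ {x} ⊆ g.source := fun z hz => (hBsub hz.1).2 hz.2
  obtain ⟨p, hpB, hps⟩ := mem_closure_iff_nhds.1 (hdense x) B hB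
  have hpx : p ≠ x := fun h => hx (h ▸ hps)
  obtain ⟨y, hy, hpy⟩ := mem_iUnion₂.1 ((hBsub hpB).1 hps)
  have hrest : IsOpen (⋃ y' ∈ g.targetᶜ \ {y}, O y') := isOpen_biUnion fun y _ => (hO y).2
  -- The image of the punctured neighbourhood is connected and covered by the disjoint sets `O y'`,
  -- so it lies in the one that it meets.
  have hmem : g '' (B \ {x}) ⊆ O y := by
    refine (hBconn.image g (g.continuousOn.mono hBs)).subset_left_of_subset_union (hO y).2 hrest
      ?_ ?_ ⟨g p, mem_image_of_mem g ⟨hpB, hpx⟩, hpy⟩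
    · refine disjoint_iUnion₂_right.2 fun y' hy' => hdisj hy hy'.1 (Ne.symm hy'.2)
    · rintro _ ⟨z, hz, rfl⟩
      obtain ⟨y', hy', hzy'⟩ := mem_iUnion₂.1 ((hBsub hz.1).1 (hBs hz))
      by_cases hyy : y' = y
      · exact Or.inl (hyy ▸ hzy')
      · exact Or.inr (mem_iUnion₂.2 ⟨y', ⟨hy', hyy⟩, hzy'⟩)
  refine ⟨y, fun N hN => ?_⟩
  obtain ⟨N', hN'N, hN'o, hyN'⟩ := mem_nhds_iff.1 hN
  -- Shrinking only the set around `y` still covers `g.targetᶜ`. As the values already lie in `O y`,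
  -- they must fall in `O y ∩ N'`.
  have h3 := hclust ((O y ∩ N') ∪ ⋃ y' ∈ g.targetᶜ \ {y}, O y')
    (((hO y).2.inter hN'o).union hrest) fun y' hy' => by
      by_cases hyy : y' = y
      · subst hyy
        exact Or.inl ⟨(hO y').1, hyN'⟩
      · exact Or.inr (mem_iUnion₂.2 ⟨y', ⟨hy', hyy⟩, (hO y').1⟩)
  change ∀ᶠ z in 𝓝[g.source] x, g z ∈ N
  rw [eventually_nhdsWithin_iff]
  filter_upwards [h3, hB] with z hz hzB hzs
  have hzO : g z ∈ O y := hmem ⟨z, ⟨hzB, fun h => hx (mem_singleton_iff.1 h ▸ hzs)⟩, rfl⟩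
  rcases hz hzs with h | h
  · exact hN'N h.2
  · obtain ⟨y', hy', hzy'⟩ := mem_iUnion₂.1 h
    exact absurd hzy' (disjoint_left.1 (hdisj hy hy'.1 (Ne.symm hy'.2)) hzO)

theorem continuous_extendFrom_of_finite_compl [T2Space X] [T2Space Y] [CompactSpace Y]
    (hV : 1 < Module.rank ℝ V) (g : OpenPartialHomeomorph X Y) (hs : g.sourceᶜ.Finite)
    (ht : g.targetᶜ.Finite) : Continuous (extendFrom g.source g) := by
  have : Nontrivial V := by
    by_contra h
    rw [not_nontrivial_iff_subsingleton] at h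
    rw [rank_subsingleton'] at hV
    exact absurd hV (by simp)
  exact continuous_extendFrom (dense_of_finite_compl (V := V) hs)
    (exists_tendsto_of_finite_compl hV g hs ht)

end Extension

/-! ### Holomorphic extension across finite sets in complex surfaces. -/

section Holomorphic

variable {X : Type*} [TopologicalSpace X] [ChartedSpace (EuclideanSpace ℂ (Fin 2)) X]
  [IsManifold 𝓘(ℂ, EuclideanSpace ℂ (Fin 2)) ω X]
  {Y : Type*} [TopologicalSpace Y] [ChartedSpace (EuclideanSpace ℂ (Fin 2)) Y]
  [IsManifold 𝓘(ℂ, EuclideanSpace ℂ (Fin 2)) ω Y]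

/-- A continuous map of complex surfaces which is holomorphic off a point is holomorphic. -/
theorem contMDiffAt_of_continuous_of_punctured {f : X → Y} (hf : Continuous f) {x : X}
    (hd : ∀ᶠ z in 𝓝 x, z ≠ x →
      ContMDiffAt 𝓘(ℂ, EuclideanSpace ℂ (Fin 2)) 𝓘(ℂ, EuclideanSpace ℂ (Fin 2)) ω f z) :
    ContMDiffAt 𝓘(ℂ, EuclideanSpace ℂ (Fin 2)) 𝓘(ℂ, EuclideanSpace ℂ (Fin 2)) ω f x := by
  set e := extChartAt 𝓘(ℂ, EuclideanSpace ℂ (Fin 2)) x with he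
  set e' := extChartAt 𝓘(ℂ, EuclideanSpace ℂ (Fin 2)) (f x) with he'
  rw [contMDiffAt_iff]
  refine ⟨hf.continuousAt, ?_⟩
  rw [ModelWithCorners.range_eq_univ, contDiffWithinAt_univ]
  have htarget : e.target ∈ 𝓝 (e x) := extChartAt_target_mem_nhds x
  have hsymm : Filter.Tendsto e.symm (𝓝 (e x)) (𝓝 x) := by
    have := (continuousAt_extChartAt_symm (I := 𝓘(ℂ, EuclideanSpace ℂ (Fin 2))) x).tendsto
    rwa [extChartAt_to_inv] at this
  have hsource : ∀ᶠ z in 𝓝 (e x), f (e.symm z) ∈ e'.source :=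
    (hf.continuousAt.tendsto.comp hsymm) (extChartAt_source_mem_nhds (f x))
  refine (analyticAt_of_differentiableAt_punctured ?_ ?_).contDiffAt
  · filter_upwards [htarget, hsource] with z hz hzs
    have h1 : ContinuousAt (f ∘ e.symm) z :=
      ContinuousAt.comp hf.continuousAt (continuousAt_extChartAt_symm'' hz)
    exact ContinuousAt.comp (g := e') (f := f ∘ e.symm)
      (continuousAt_extChartAt' (by simpa [he'] using hzs)) h1
  · filter_upwards [htarget, hsource, hsymm.eventually hd] with z hz hzs hzd hne
    have hzx : e.symm z ≠ x := fun h => hne (by rw [← e.right_inv hz, h])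
    have h1 : ContMDiffAt 𝓘(ℂ, EuclideanSpace ℂ (Fin 2)) 𝓘(ℂ, EuclideanSpace ℂ (Fin 2)) ω
        (e' ∘ f ∘ e.symm) z :=
      (contMDiffAt_extChartAt' (by simpa [he'] using hzs)).comp z ((hzd hzx).comp z
        ((contMDiffOn_extChartAt_symm x).contMDiffAt ((isOpen_extChartAt_target x).mem_nhds hz)))
    exact h1.mdifferentiableAt (by simp) |>.differentiableAt

/-- A biholomorphic map between the complements of finite sets in compact complex surfaces
extends to a holomorphic map. -/
theorem contMDiff_extendFrom_of_finite_compl [T2Space X] [T2Space Y]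
    [CompactSpace Y] (g : OpenPartialHomeomorph X Y) (hs : g.sourceᶜ.Finite)
    (ht : g.targetᶜ.Finite)
    (hg : ContMDiffOn 𝓘(ℂ, EuclideanSpace ℂ (Fin 2)) 𝓘(ℂ, EuclideanSpace ℂ (Fin 2)) ω
      g g.source) :
    ContMDiff 𝓘(ℂ, EuclideanSpace ℂ (Fin 2)) 𝓘(ℂ, EuclideanSpace ℂ (Fin 2)) ω
      (extendFrom g.source g) ∧ Set.EqOn (extendFrom g.source g) g g.source := by
  have hV : 1 < Module.rank ℝ (EuclideanSpace ℂ (Fin 2)) := by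
    apply Module.one_lt_rank_of_one_lt_finrank
    rw [finrank_real_of_complex]
    simp
  have heq : Set.EqOn (extendFrom g.source g) g g.source := fun x hx =>
    extendFrom_eq (subset_closure hx)
      ((g.continuousAt hx).tendsto.mono_left nhdsWithin_le_nhds)
  have hsmooth : ∀ x ∈ g.source, ContMDiffAt 𝓘(ℂ, EuclideanSpace ℂ (Fin 2))
      𝓘(ℂ, EuclideanSpace ℂ (Fin 2)) ω (extendFrom g.source g) x := fun x hx =>
    ((hg x hx).contMDiffAt (g.open_source.mem_nhds hx)).congr_of_eventuallyEq
      (heq.eventuallyEq_of_mem (g.open_source.mem_nhds hx))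
  refine ⟨fun x => ?_, heq⟩
  refine contMDiffAt_of_continuous_of_punctured
    (continuous_extendFrom_of_finite_compl hV g hs ht) ?_
  have hfin : (g.sourceᶜ \ {x}).Finite := hs.subset Set.sdiff_subset
  filter_upwards [hfin.isClosed.isOpen_compl.mem_nhds (fun h => h.2 rfl)] with z hz hne
  refine hsmooth z ?_
  by_contra h
  exact hz ⟨h, hne⟩

/-- A biholomorphic map between the complements of finite sets in compact complex surfaces
extends to a biholomorphic map. -/
theorem exists_diffeomorph_of_finite_compl [T2Space X] [CompactSpace X] [T2Space Y]
    [CompactSpace Y] (g : OpenPartialHomeomorph X Y) (hs : g.sourceᶜ.Finite)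
    (ht : g.targetᶜ.Finite)
    (hg : ContMDiffOn 𝓘(ℂ, EuclideanSpace ℂ (Fin 2)) 𝓘(ℂ, EuclideanSpace ℂ (Fin 2)) ω
      g g.source)
    (hg' : ContMDiffOn 𝓘(ℂ, EuclideanSpace ℂ (Fin 2)) 𝓘(ℂ, EuclideanSpace ℂ (Fin 2)) ω
      g.symm g.target) :
    Nonempty (X ≃ₘ^ω⟮𝓘(ℂ, EuclideanSpace ℂ (Fin 2)), 𝓘(ℂ, EuclideanSpace ℂ (Fin 2))⟯ Y) := by
  obtain ⟨h, heq⟩ := contMDiff_extendFrom_of_finite_compl g hs ht hg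
  obtain ⟨h', heq'⟩ := contMDiff_extendFrom_of_finite_compl g.symm ht hs hg'
  -- Each composite is continuous and equals the identity on a dense set, hence everywhere, the
  -- surfaces being Hausdorff.
  refine ⟨⟨⟨extendFrom g.source g, extendFrom g.target g.symm, ?_, ?_⟩, h, h'⟩⟩
  · refine congrFun (Continuous.ext_on (dense_of_finite_compl (V := EuclideanSpace ℂ (Fin 2)) hs)
      (h'.continuous.comp h.continuous) continuous_id fun x hx => ?_)
    exact (congrArg _ (heq hx)).trans ((heq' (g.map_source hx)).trans (g.left_inv hx))
  · refine congrFun (Continuous.ext_on (dense_of_finite_compl (V := EuclideanSpace ℂ (Fin 2)) ht)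
      (h.continuous.comp h'.continuous) continuous_id fun y hy => ?_)
    exact (congrArg _ (heq' hy)).trans ((heq (g.map_target hy)).trans (g.right_inv hy))

end Holomorphic

noncomputable section

/-! ### The differential of a map in charts -/

section Charts

variable {𝕜 : Type*} [NontriviallyNormedField 𝕜]
  {V : Type*} [NormedAddCommGroup V] [NormedSpace 𝕜 V]
  {V' : Type*} [NormedAddCommGroup V'] [NormedSpace 𝕜 V']
  {M : Type*} [TopologicalSpace M] [ChartedSpace V M]
  {N : Type*} [TopologicalSpace N] [ChartedSpace V' N]

theorem tendsto_extChartAt_symm_self (x : M) :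
    Filter.Tendsto (extChartAt 𝓘(𝕜, V) x).symm (𝓝 (extChartAt 𝓘(𝕜, V) x x)) (𝓝 x) := by
  have := (continuousAt_extChartAt_symm (I := 𝓘(𝕜, V)) x).tendsto
  rwa [extChartAt_to_inv] at this

theorem writtenInExtChartAt_self (x : M) (f : M → N) :
    writtenInExtChartAt 𝓘(𝕜, V) 𝓘(𝕜, V') x f (extChartAt 𝓘(𝕜, V) x x) =
      extChartAt 𝓘(𝕜, V') (f x) (f x) := by
  simp [writtenInExtChartAt]

/-- The scalar field is left general since Higgs fields need the case `ℂ`, and forms and connections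
the case `ℝ`. -/
theorem eventually_extChartAt_symm_writtenInExtChartAt {f : M → N} (hf : Continuous f) (x : M) :
    ∀ᶠ z in 𝓝 (extChartAt 𝓘(𝕜, V) x x),
      (extChartAt 𝓘(𝕜, V') (f x)).symm (writtenInExtChartAt 𝓘(𝕜, V) 𝓘(𝕜, V') x f z) =
        f ((extChartAt 𝓘(𝕜, V) x).symm z) := by
  have : ∀ᶠ z in 𝓝 (extChartAt 𝓘(𝕜, V) x x),
      f ((extChartAt 𝓘(𝕜, V) x).symm z) ∈ (extChartAt 𝓘(𝕜, V') (f x)).source :=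
    (hf.continuousAt.tendsto.comp (tendsto_extChartAt_symm_self x))
      (extChartAt_source_mem_nhds (f x))
  filter_upwards [this] with z hz
  exact (extChartAt 𝓘(𝕜, V') (f x)).left_inv hz

theorem ContMDiff.contDiffAt_writtenInExtChartAt {n : WithTop ℕ∞} {f : M → N}
    (hf : ContMDiff 𝓘(𝕜, V) 𝓘(𝕜, V') n f) (x : M) :
    ContDiffAt 𝕜 n (writtenInExtChartAt 𝓘(𝕜, V) 𝓘(𝕜, V') x f) (extChartAt 𝓘(𝕜, V) x x) := by
  have := ((contMDiffAt_iff (I := 𝓘(𝕜, V)) (I' := 𝓘(𝕜, V'))).1 (hf x)).2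
  rwa [ModelWithCorners.range_eq_univ, contDiffWithinAt_univ] at this

/-- The chain rule for `f ∘ (extChartAt x).symm = (extChartAt (f x)).symm ∘ h`, where `h` is the map
`f` in the charts at `x` and `f x`. -/
theorem ContMDiff.eventually_mfderiv_extChartAt_symm [IsManifold 𝓘(𝕜, V) ω M]
    [IsManifold 𝓘(𝕜, V') ω N] {f : M → N} (hf : ContMDiff 𝓘(𝕜, V) 𝓘(𝕜, V') ω f) (x : M) :
    ∀ᶠ z in 𝓝 (extChartAt 𝓘(𝕜, V) x x), ∀ v : V,
      (mfderiv 𝓘(𝕜, V) 𝓘(𝕜, V') f ((extChartAt 𝓘(𝕜, V) x).symm z)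
        (mfderiv 𝓘(𝕜, V) 𝓘(𝕜, V) (extChartAt 𝓘(𝕜, V) x).symm z v) : V') =
      mfderiv 𝓘(𝕜, V') 𝓘(𝕜, V') (extChartAt 𝓘(𝕜, V') (f x)).symm
        (writtenInExtChartAt 𝓘(𝕜, V) 𝓘(𝕜, V') x f z)
        (fderiv 𝕜 (writtenInExtChartAt 𝓘(𝕜, V) 𝓘(𝕜, V') x f) z v) := by
  have h1 := (eventually_extChartAt_symm_writtenInExtChartAt (𝕜 := 𝕜) (V := V) (V' := V')
    hf.continuous x
    ).eventually_nhds
  have h2 : ∀ᶠ z in 𝓝 (extChartAt 𝓘(𝕜, V) x x), z ∈ (extChartAt 𝓘(𝕜, V) x).target :=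
    extChartAt_target_mem_nhds x
  have h3 := ((hf.contDiffAt_writtenInExtChartAt x).of_le (m := 1) (by simp)).eventually (by simp)
  have h4 : ∀ᶠ z in 𝓝 (extChartAt 𝓘(𝕜, V) x x),
      writtenInExtChartAt 𝓘(𝕜, V) 𝓘(𝕜, V') x f z ∈ (extChartAt 𝓘(𝕜, V') (f x)).target := by
    refine (hf.contDiffAt_writtenInExtChartAt x).continuousAt ?_
    rw [writtenInExtChartAt_self]
    exact extChartAt_target_mem_nhds (f x)
  filter_upwards [h1, h2, h3, h4] with z hz1 hz2 hz3 hz4 v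
  have d1 : MDifferentiableAt 𝓘(𝕜, V) 𝓘(𝕜, V) (extChartAt 𝓘(𝕜, V) x).symm z :=
    ((contMDiffOn_extChartAt_symm (n := ω) x).contMDiffAt
      ((isOpen_extChartAt_target x).mem_nhds hz2)).mdifferentiableAt (by simp)
  have d2 : MDifferentiableAt 𝓘(𝕜, V') 𝓘(𝕜, V') (extChartAt 𝓘(𝕜, V') (f x)).symm
      (writtenInExtChartAt 𝓘(𝕜, V) 𝓘(𝕜, V') x f z) :=
    ((contMDiffOn_extChartAt_symm (n := ω) (f x)).contMDiffAt
      ((isOpen_extChartAt_target (f x)).mem_nhds hz4)).mdifferentiableAt (by simp)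
  have d3 : MDifferentiableAt 𝓘(𝕜, V) 𝓘(𝕜, V') f ((extChartAt 𝓘(𝕜, V) x).symm z) :=
    (hf _).mdifferentiableAt (by simp)
  have d4 : MDifferentiableAt 𝓘(𝕜, V) 𝓘(𝕜, V')
      (writtenInExtChartAt 𝓘(𝕜, V) 𝓘(𝕜, V') x f) z :=
    (hz3.differentiableAt (by simp)).mdifferentiableAt
  have c1 := mfderiv_comp z d3 d1
  have c2 := mfderiv_comp z d2 d4
  have e : f ∘ (extChartAt 𝓘(𝕜, V) x).symm =ᶠ[𝓝 z]
      (extChartAt 𝓘(𝕜, V') (f x)).symm ∘ writtenInExtChartAt 𝓘(𝕜, V) 𝓘(𝕜, V') x f := by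
    filter_upwards [hz1] with z' hz'
    exact hz'.symm
  have c3 := e.mfderiv_eq (I := 𝓘(𝕜, V)) (I' := 𝓘(𝕜, V'))
  have c4 : (mfderiv 𝓘(𝕜, V) 𝓘(𝕜, V') (f ∘ (extChartAt 𝓘(𝕜, V) x).symm) z : V →L[𝕜] V') v =
    (mfderiv 𝓘(𝕜, V) 𝓘(𝕜, V') ((extChartAt 𝓘(𝕜, V') (f x)).symm ∘
      writtenInExtChartAt 𝓘(𝕜, V) 𝓘(𝕜, V') x f) z : V →L[𝕜] V') v :=
    congrArg (fun T : V →L[𝕜] V' => T v) c3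
  rw [mfderiv_eq_fderiv] at c2
  exact (congrArg (fun T : V →L[𝕜] V' => T v) c1).symm.trans
    (c4.trans (congrArg (fun T : V →L[𝕜] V' => T v) c2))

end Charts

/-! ### Complex manifolds as real manifolds -/

section Real

variable {V : Type*} [NormedAddCommGroup V] [NormedSpace ℂ V]
  {X : Type*} [TopologicalSpace X] [ChartedSpace V X]
  {V' : Type*} [NormedAddCommGroup V'] [NormedSpace ℂ V']
  {Y : Type*} [TopologicalSpace Y] [ChartedSpace V' Y]

theorem IsManifold.real_of_complex [IsManifold 𝓘(ℂ, V) ω X] : IsManifold 𝓘(ℝ, V) ω X := by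
  refine isManifold_of_contDiffOn _ _ _ fun e e' he he' => ?_
  have h : e.symm ≫ₕ e' ∈ contDiffGroupoid ω 𝓘(ℂ, V) :=
    StructureGroupoid.compatible _ he he'
  rw [contDiffGroupoid, mem_groupoid_of_pregroupoid] at h
  exact ContDiffOn.restrict_scalars ℝ h.1

theorem ContMDiff.real_of_complex [IsManifold 𝓘(ℂ, V) ω X] [IsManifold 𝓘(ℂ, V') ω Y]
    {f : X → Y} (hf : ContMDiff 𝓘(ℂ, V) 𝓘(ℂ, V') ω f) : ContMDiff 𝓘(ℝ, V) 𝓘(ℝ, V') ω f := by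
  intro x
  have h := contMDiffAt_iff.1 (hf x)
  rw [contMDiffAt_iff]
  exact ⟨h.1, h.2.restrict_scalars ℝ⟩

end Real

namespace Higgs

/-! ### Pullback of Higgs bundles -/

section Pullback

theorem pullback_symm_apply {F : Type*} [TopologicalSpace F] {X Y : Type*} [TopologicalSpace X]
    [TopologicalSpace Y] {E : Y → Type*} [∀ x, AddCommMonoid (E x)]
    [∀ x, TopologicalSpace (E x)] [TopologicalSpace (TotalSpace F E)] [FiberBundle F E]
    (f : C(X, Y)) (b x : X)
    (hx : f x ∈ (trivializationAt F E (f b)).baseSet) (w : F) :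
    (trivializationAt F ((f : X → Y) *ᵖ E) b).symm x w =
      (trivializationAt F E (f b)).symm (f x) w := by
  rw [Trivialization.symm_apply]
  · rfl
  · exact hx

variable {V : Type*} [NormedAddCommGroup V] [NormedSpace ℂ V]
  {X : Type*} [TopologicalSpace X] [ChartedSpace V X]
  {V' : Type*} [NormedAddCommGroup V'] [NormedSpace ℂ V']
  {Y : Type*} [TopologicalSpace Y] [ChartedSpace V' Y]

section

variable {F : Type*} [NormedAddCommGroup F] [NormedSpace ℂ F]
  {E : Y → Type*} [∀ x, AddCommMonoid (E x)] [∀ x, Module ℂ (E x)]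
  [∀ x, TopologicalSpace (E x)] [TopologicalSpace (TotalSpace F E)] [FiberBundle F E]

/-- The endomorphism `φ u` at `y`, applied to the vector `w`, in the trivialization at `b`. -/
def localEndForm (φ : ∀ y : Y, TangentSpace 𝓘(ℂ, V') y →ₗ[ℂ] End ℂ (E y)) (b y : Y) (u : V')
    (w : F) : F :=
  (trivializationAt F E b (TotalSpace.mk' F y (φ y u ((trivializationAt F E b).symm y w)))).2

/-- Over the base set the trivialization is fibrewise linear, so the local form is linear in the
tangent vector. -/
theorem localEndForm_sum [VectorBundle ℂ F E]
    (φ : ∀ y : Y, TangentSpace 𝓘(ℂ, V') y →ₗ[ℂ] End ℂ (E y)) {b y : Y}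
    (hy : y ∈ (trivializationAt F E b).baseSet) {ι : Type*} (s : Finset ι) (a : ι → ℂ)
    (u : ι → V') (w : F) :
    localEndForm φ b y (∑ i ∈ s, a i • u i) w = ∑ i ∈ s, a i • localEndForm φ b y (u i) w := by
  let T : TangentSpace 𝓘(ℂ, V') y →ₗ[ℂ] F :=
    (((trivializationAt F E b).linear ℂ hy).mk').comp
      ((LinearMap.applyₗ ((trivializationAt F E b).symm y w)).comp (φ y))
  have h : ∀ v : V', localEndForm φ b y v w = T v := fun _ => rfl
  simp only [h]
  exact (map_sum T _ s).trans (Finset.sum_congr rfl fun i _ => map_smul T (a i) (u i))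

end

theorem IsHolomorphicEndForm.pullback [FiniteDimensional ℂ V'] [IsManifold 𝓘(ℂ, V) ω X]
    [IsManifold 𝓘(ℂ, V') ω Y] {F : Type*} [NormedAddCommGroup F] [NormedSpace ℂ F]
    {E : Y → Type*} [∀ x, AddCommMonoid (E x)] [∀ x, Module ℂ (E x)]
    [∀ x, TopologicalSpace (E x)] [TopologicalSpace (TotalSpace F E)] [FiberBundle F E]
    [VectorBundle ℂ F E]
    {φ : ∀ y : Y, TangentSpace 𝓘(ℂ, V') y →ₗ[ℂ] End ℂ (E y)}
    (hφ : IsHolomorphicEndForm V' F E φ) (f : C^ω⟮𝓘(ℂ, V), X; 𝓘(ℂ, V'), Y⟯) :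
    IsHolomorphicEndForm V F ((f : X → Y) *ᵖ E) (pullbackHiggs f φ) := by
  intro x v w
  set h := writtenInExtChartAt 𝓘(ℂ, V) 𝓘(ℂ, V') x f with hh
  set z₀ := extChartAt 𝓘(ℂ, V) x x with hz₀
  have hana : ContDiffAt ℂ ω h z₀ := f.contMDiff.contDiffAt_writtenInExtChartAt x
  have hana' : AnalyticAt ℂ h z₀ := hana.analyticAt
  have hder : AnalyticAt ℂ (fun z => fderiv ℂ h z v) z₀ :=
    ((ContinuousLinearMap.apply ℂ V' v).analyticAt _).fun_comp hana'.fderiv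
  -- Holomorphy of `φ` is given for constant vectors, whereas `fderiv ℂ h z v` varies with `z`.
  -- Expanding it in a basis gives analytic coefficients times values on constant vectors.
  let b := Module.finBasis ℂ V'
  have hcoord : ∀ i, AnalyticAt ℂ (fun z => b.repr (fderiv ℂ h z v) i) z₀ := fun i =>
    ((LinearMap.toContinuousLinearMap (b.coord i)).analyticAt _).fun_comp hder
  have hloc : ∀ i, AnalyticAt ℂ (fun z => localEndForm φ (f x)
      ((extChartAt 𝓘(ℂ, V') (f x)).symm (h z)) (chartInvDeriv (f x) (h z) (b i)) w) z₀ := by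
    intro i
    have : AnalyticAt ℂ (fun z' => localEndForm φ (f x)
      ((extChartAt 𝓘(ℂ, V') (f x)).symm z') (chartInvDeriv (f x) z' (b i)) w) (h z₀) := by
      rw [hh, hz₀, writtenInExtChartAt_self]
      exact hφ (f x) (b i) w
    exact this.fun_comp hana'
  have hsum : AnalyticAt ℂ (fun z => ∑ i, b.repr (fderiv ℂ h z v) i • localEndForm φ (f x)
      ((extChartAt 𝓘(ℂ, V') (f x)).symm (h z)) (chartInvDeriv (f x) (h z) (b i)) w) z₀ :=
    Finset.analyticAt_fun_sum _ fun i _ => (hcoord i).smul (hloc i)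
  refine hsum.congr ?_
  have hbase : ∀ᶠ z in 𝓝 z₀, f ((extChartAt 𝓘(ℂ, V) x).symm z) ∈
      (trivializationAt F E (f x)).baseSet :=
    (f.contMDiff.continuous.continuousAt.tendsto.comp (tendsto_extChartAt_symm_self x))
      ((trivializationAt F E (f x)).open_baseSet.mem_nhds (mem_baseSet_trivializationAt F E (f x)))
  filter_upwards [hbase, f.contMDiff.eventually_mfderiv_extChartAt_symm x,
    eventually_extChartAt_symm_writtenInExtChartAt (𝕜 := ℂ) (V := V) (V' := V')
      f.contMDiff.continuous x] with z hz1 hz2 hz3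
  have e1 : (trivializationAt F ((f : X → Y) *ᵖ E) x (TotalSpace.mk' F
      ((extChartAt 𝓘(ℂ, V) x).symm z) (pullbackHiggs f φ _ (chartInvDeriv x z v)
        ((trivializationAt F ((f : X → Y) *ᵖ E) x).symm _ w)))).2 =
      localEndForm φ (f x) (f ((extChartAt 𝓘(ℂ, V) x).symm z))
        (mfderiv 𝓘(ℂ, V) 𝓘(ℂ, V') f ((extChartAt 𝓘(ℂ, V) x).symm z)
          (mfderiv 𝓘(ℂ, V) 𝓘(ℂ, V) (extChartAt 𝓘(ℂ, V) x).symm z v)) w := by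
    have := pullback_symm_apply (F := F) (E := E) (f : C(X, Y)) x
      ((extChartAt 𝓘(ℂ, V) x).symm z) hz1 w
    exact congrArg (fun w' : E (f ((extChartAt 𝓘(ℂ, V) x).symm z)) =>
      (trivializationAt F E (f x) (TotalSpace.mk' F (f ((extChartAt 𝓘(ℂ, V) x).symm z))
        (φ _ (mfderiv 𝓘(ℂ, V) 𝓘(ℂ, V') f ((extChartAt 𝓘(ℂ, V) x).symm z)
          (mfderiv 𝓘(ℂ, V) 𝓘(ℂ, V) (extChartAt 𝓘(ℂ, V) x).symm z v)) w'))).2) this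
  refine Eq.trans ?_ e1.symm
  have e2 : localEndForm φ (f x) (f ((extChartAt 𝓘(ℂ, V) x).symm z))
        (mfderiv 𝓘(ℂ, V) 𝓘(ℂ, V') f ((extChartAt 𝓘(ℂ, V) x).symm z)
          (mfderiv 𝓘(ℂ, V) 𝓘(ℂ, V) (extChartAt 𝓘(ℂ, V) x).symm z v)) w =
      localEndForm φ (f x) ((extChartAt 𝓘(ℂ, V') (f x)).symm (h z))
        (chartInvDeriv (f x) (h z) (fderiv ℂ h z v)) w := by
    rw [hh, hz3]
    exact congrArg (fun u => localEndForm φ (f x) (f ((extChartAt 𝓘(ℂ, V) x).symm z)) u w) (hz2 v)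
  refine Eq.trans ?_ e2.symm
  have hz1' : (extChartAt 𝓘(ℂ, V') (f x)).symm (h z) ∈ (trivializationAt F E (f x)).baseSet := by
    rw [hh, hz3]; exact hz1
  refine (localEndForm_sum φ hz1' Finset.univ (fun i => b.repr (fderiv ℂ h z v) i)
    (fun i => chartInvDeriv (X := Y) (f x) (h z) (b i)) w).symm.trans
    (congrArg (fun u => localEndForm φ (f x) ((extChartAt 𝓘(ℂ, V') (f x)).symm (h z)) u w) ?_)
  have e3 : ∑ i, b.repr (fderiv ℂ h z v) i • b i = fderiv ℂ h z v := b.sum_repr _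
  have e4 := congrArg (chartInvDeriv (X := Y) (f x) (h z)) e3
  exact ((map_sum (chartInvDeriv (X := Y) (f x) (h z)) _ _).trans (Finset.sum_congr rfl fun i _ =>
    map_smul (chartInvDeriv (X := Y) (f x) (h z)) _ _)).symm.trans e4

theorem IsHiggsField.pullback [FiniteDimensional ℂ V'] [IsManifold 𝓘(ℂ, V) ω X]
    [IsManifold 𝓘(ℂ, V') ω Y] {F : Type*} [NormedAddCommGroup F] [NormedSpace ℂ F]
    {E : Y → Type*} [∀ x, AddCommMonoid (E x)] [∀ x, Module ℂ (E x)]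
    [∀ x, TopologicalSpace (E x)] [TopologicalSpace (TotalSpace F E)] [FiberBundle F E]
    [VectorBundle ℂ F E]
    {φ : ∀ y : Y, TangentSpace 𝓘(ℂ, V') y →ₗ[ℂ] End ℂ (E y)}
    (hφ : IsHiggsField V' F E φ) (f : C^ω⟮𝓘(ℂ, V), X; 𝓘(ℂ, V'), Y⟯) :
    IsHiggsField V F ((f : X → Y) *ᵖ E) (pullbackHiggs f φ) :=
  ⟨hφ.1.pullback f, fun x u v => hφ.2 (f x) (mfderiv 𝓘(ℂ, V) 𝓘(ℂ, V') f x u)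
    (mfderiv 𝓘(ℂ, V) 𝓘(ℂ, V') f x v)⟩

/-- Pulling back a Higgs bundle along `f ∘ g` or successively along `f` and `g` gives the same
condition of semistability. -/
theorem IsSemistableOnCurve.pullback_pullback [IsManifold 𝓘(ℂ, V) ω X]
    [IsManifold 𝓘(ℂ, V') ω Y] {r : ℕ}
    {E : Y → Type*} [∀ x, AddCommMonoid (E x)] [∀ x, Module ℂ (E x)]
    [∀ x, TopologicalSpace (E x)] [TopologicalSpace (TotalSpace (EuclideanSpace ℂ (Fin r)) E)]
    [FiberBundle (EuclideanSpace ℂ (Fin r)) E]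
    {φ : ∀ y : Y, TangentSpace 𝓘(ℂ, V') y →ₗ[ℂ] End ℂ (E y)}
    {C : Type*} [TopologicalSpace C] [ChartedSpace ℂ C] [IsManifold 𝓘(ℂ) ω C]
    (f : C^ω⟮𝓘(ℂ, V), X; 𝓘(ℂ, V'), Y⟯) (g : C^ω⟮𝓘(ℂ), C; 𝓘(ℂ, V), X⟯)
    (h : IsSemistableOnCurve r ((f.comp g : C^ω⟮𝓘(ℂ), C; 𝓘(ℂ, V'), Y⟯) *ᵖ E)
      (pullbackHiggs (f.comp g : C^ω⟮𝓘(ℂ), C; 𝓘(ℂ, V'), Y⟯) φ)) :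
    IsSemistableOnCurve r ((g : C → X) *ᵖ ((f : X → Y) *ᵖ E))
      (pullbackHiggs (V := V) g (pullbackHiggs (W := V) f φ)) := by
  intro s hs hsr G _ _ _ _ _ _ _ j ψ hj hdense hψ hcomm
  -- The iterated pullback bundle is the pullback along the composite by definition, so the same
  -- `G`, `j`, `ψ` serve as a test; only the Higgs fields need comparison, by the chain rule.
  refine h s hs hsr G j ψ hj hdense hψ fun x v w => ?_
  have hchain : mfderiv 𝓘(ℂ) 𝓘(ℂ, V') (f.comp g : C^ω⟮𝓘(ℂ), C; 𝓘(ℂ, V'), Y⟯) x =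
      (mfderiv 𝓘(ℂ, V) 𝓘(ℂ, V') f (g x)).comp (mfderiv 𝓘(ℂ) 𝓘(ℂ, V) g x) :=
    mfderiv_comp x (f.contMDiff.mdifferentiable (by simp) _)
      (g.contMDiff.mdifferentiable (by simp) _)
  refine Eq.trans ?_ (hcomm x v w)
  exact congrArg (fun T : TangentSpace 𝓘(ℂ) x →L[ℂ] TangentSpace 𝓘(ℂ, V') (f (g x)) =>
    φ (f (g x)) (T v) (j x w)) hchain

end Pullback

end Higgs

/-! ### Smoothness of pullbacks of alternating maps -/

section Alternating

variable {V : Type*} [NormedAddCommGroup V] [NormedSpace ℝ V]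
  {V' : Type*} [NormedAddCommGroup V'] [NormedSpace ℝ V']
  {W : Type*} [NormedAddCommGroup W] [NormedSpace ℝ W]
  {G : Type*} [NormedAddCommGroup G] [NormedSpace ℝ G]

/-- Alternatization multiplies an alternating map by `k!`, so dividing by `k!` gives a continuous
retraction. Smoothness can then be checked among multilinear maps. -/
theorem ContinuousAlternatingMap.exists_leftInverse_toContinuousMultilinearMap (k : ℕ) :
    ∃ A : ContinuousMultilinearMap ℝ (fun _ : Fin k => V) W →L[ℝ] V [⋀^Fin k]→L[ℝ] W,
      ∀ η : V [⋀^Fin k]→L[ℝ] W, A η.toContinuousMultilinearMap = η := by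
  let A : ContinuousMultilinearMap ℝ (fun _ : Fin k => V) W →L[ℝ] V [⋀^Fin k]→L[ℝ] W :=
    LinearMap.mkContinuous
      { toFun := fun f => ContinuousMultilinearMap.alternatization f
        map_add' := fun f g => map_add _ f g
        map_smul' := fun c f => by
          ext v
          simp [ContinuousMultilinearMap.alternatization_apply_apply, Finset.smul_sum,
            smul_comm c] } (Fintype.card (Equiv.Perm (Fin k))) fun f => by
      refine ContinuousAlternatingMap.opNorm_le_bound _ (by positivity) fun v => ?_
      rw [LinearMap.coe_mk, AddHom.coe_mk,
        ContinuousMultilinearMap.alternatization_apply_apply]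
      refine (norm_sum_le _ _).trans ?_
      have : ∀ σ ∈ (Finset.univ : Finset (Equiv.Perm (Fin k))),
          ‖Equiv.Perm.sign σ • f (v ∘ σ)‖ ≤ ‖f‖ * ∏ i, ‖v i‖ := fun σ _ => by
        have h1 : ‖Equiv.Perm.sign σ • f (v ∘ σ)‖ = ‖f (v ∘ σ)‖ := by
          rcases Int.units_eq_one_or (Equiv.Perm.sign σ) with h | h <;> simp [h]
        rw [h1, ← Equiv.prod_comp σ fun i => ‖v i‖]
        exact f.le_opNorm _
      refine (Finset.sum_le_card_nsmul _ _ _ this).trans (le_of_eq ?_)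
      rw [Finset.card_univ, nsmul_eq_mul, mul_assoc]
  refine ⟨((k.factorial : ℝ)⁻¹) • A, fun η => ?_⟩
  ext v
  have h : A η.toContinuousMultilinearMap v = (k.factorial : ℝ) • η v := by
    have := congrArg (fun a : V [⋀^Fin k]→ₗ[ℝ] W => a v) η.toAlternatingMap.coe_alternatization
    simp only [AlternatingMap.smul_apply, Fintype.card_fin] at this
    rw [← Nat.cast_smul_eq_nsmul ℝ] at this
    refine Eq.trans ?_ this
    have h2 := congrArg (fun a : V [⋀^Fin k]→ₗ[ℝ] W => a v)
      (ContinuousMultilinearMap.alternatization_apply_toAlternatingMap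
        η.toContinuousMultilinearMap)
    exact h2
  rw [_root_.smul_apply, ContinuousAlternatingMap.smul_apply, h, smul_smul,
    inv_mul_cancel₀ (by exact_mod_cast k.factorial_ne_zero), one_smul]

/-- Composition is multilinear in the `k` copies of `T` and linear in `η`, hence smooth among
multilinear maps; the retraction `A` brings the result back. -/
theorem ContDiffAt.continuousAlternatingMap_compContinuousLinearMap {n : WithTop ℕ∞} {k : ℕ}
    {η : G → V [⋀^Fin k]→L[ℝ] W} {T : G → V' →L[ℝ] V} {x : G} (hη : ContDiffAt ℝ n η x)
    (hT : ContDiffAt ℝ n T x) :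
    ContDiffAt ℝ n (fun z => (η z).compContinuousLinearMap (T z)) x := by
  obtain ⟨A, hA⟩ :=
    ContinuousAlternatingMap.exists_leftInverse_toContinuousMultilinearMap (V := V') (W := W) k
  let M := ContinuousMultilinearMap.compContinuousLinearMapContinuousMultilinear ℝ
    (fun _ : Fin k => V') (fun _ : Fin k => V) W
  have h1 : ContDiffAt ℝ n (fun z => M fun _ => T z) x :=
    (M.contDiff.contDiffAt).comp x (contDiffAt_pi.2 fun _ => hT)
  have h2 : ContDiffAt ℝ n (fun z => (η z).toContinuousMultilinearMap) x :=
    (ContinuousAlternatingMap.toContinuousMultilinearMapCLM ℝ (𝕜 := ℝ) (E := V) (F := W)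
      (ι := Fin k)).contDiff.contDiffAt.comp x hη
  have h3 := (A.contDiff.contDiffAt).comp x (h1.clm_apply h2)
  refine h3.congr_of_eventuallyEq (.of_forall fun z => ?_)
  exact (hA _).symm

/-- The exterior derivative of 1-forms commutes with pullback, in terms of the Fréchet
derivative. -/
theorem fderiv_sub_fderiv_of_eventuallyEq_comp {B : V' → V' →L[ℝ] W} {c : V → V'} {z : V}
    {A : V → V →L[ℝ] W} (hB : DifferentiableAt ℝ B (c z)) (hc : ContDiffAt ℝ ω c z)
    (hA : A =ᶠ[𝓝 z] fun z => (B (c z)).comp (fderiv ℝ c z)) (u v : V) :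
    fderiv ℝ A z u v - fderiv ℝ A z v u =
      fderiv ℝ B (c z) (fderiv ℝ c z u) (fderiv ℝ c z v) -
        fderiv ℝ B (c z) (fderiv ℝ c z v) (fderiv ℝ c z u) := by
  have hdd : DifferentiableAt ℝ (fderiv ℝ c) z :=
    (hc.fderiv_right (m := 1) (by simp)).differentiableAt (by simp)
  have hBc : HasFDerivAt (fun z => B (c z)) ((fderiv ℝ B (c z)).comp (fderiv ℝ c z)) z :=
    hB.hasFDerivAt.comp z (hc.differentiableAt (by simp)).hasFDerivAt
  have hAd := hBc.clm_comp hdd.hasFDerivAt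
  have hA1 : ∀ u v, fderiv ℝ A z u v = B (c z) (fderiv ℝ (fderiv ℝ c) z u v) +
      fderiv ℝ B (c z) (fderiv ℝ c z u) (fderiv ℝ c z v) := by
    intro u v
    rw [hA.fderiv_eq, hAd.fderiv]
    rfl
  -- The second derivative of `c` is symmetric, so its contribution cancels on antisymmetrizing.
  have hsymm : fderiv ℝ (fderiv ℝ c) z u v = fderiv ℝ (fderiv ℝ c) z v u :=
    hc.isSymmSndFDerivAt (by simp) u v
  rw [hA1, hA1, hsymm]
  abel

end Alternating

namespace Higgs

/-! ### Pullback of differential forms -/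

section FormPullback

variable {V : Type*} [NormedAddCommGroup V] [NormedSpace ℂ V]
  {X : Type*} [TopologicalSpace X] [ChartedSpace V X]
  {V' : Type*} [NormedAddCommGroup V'] [NormedSpace ℂ V']
  {Y : Type*} [TopologicalSpace Y] [ChartedSpace V' Y]

variable (V V') in
/-- The differential over `ℝ` of a map of complex manifolds. -/
def realDeriv (f : X → Y) (x : X) : V →L[ℝ] V' :=
  mfderiv 𝓘(ℝ, V) 𝓘(ℝ, V') f x

variable (V V') in
/-- A map of complex manifolds in the preferred charts at `x` and at `f x`. -/
def chartMap (f : X → Y) (x : X) : V → V' :=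
  writtenInExtChartAt 𝓘(ℝ, V) 𝓘(ℝ, V') x f

theorem chartMap_self (f : X → Y) (x : X) :
    chartMap V V' f x (extChartAt 𝓘(ℝ, V) x x) = extChartAt 𝓘(ℝ, V') (f x) (f x) :=
  writtenInExtChartAt_self x f

variable [IsManifold 𝓘(ℂ, V) ω X] [IsManifold 𝓘(ℂ, V') ω Y] {f : X → Y}

theorem contDiffAt_chartMap (hf : ContMDiff 𝓘(ℂ, V) 𝓘(ℂ, V') ω f) (x : X) :
    ContDiffAt ℝ ω (chartMap V V' f x) (extChartAt 𝓘(ℝ, V) x x) :=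
  hf.real_of_complex.contDiffAt_writtenInExtChartAt x

theorem contDiffAt_fderiv_chartMap (hf : ContMDiff 𝓘(ℂ, V) 𝓘(ℂ, V') ω f) (x : X) :
    ContDiffAt ℝ ∞ (fderiv ℝ (chartMap V V' f x)) (extChartAt 𝓘(ℝ, V) x x) :=
  ((contDiffAt_chartMap hf x).of_le (m := ∞ + 1) (by simp)).fderiv_right le_rfl

/-- Needed on a neighbourhood and not just at the centre of the chart, because exterior derivative
and curvature differentiate the chart expressions. -/
theorem eventually_realDeriv_comp (hf : ContMDiff 𝓘(ℂ, V) 𝓘(ℂ, V') ω f) (x : X) :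
    ∀ᶠ z in 𝓝 (extChartAt 𝓘(ℝ, V) x x),
      f ((extChartAt 𝓘(ℝ, V) x).symm z) =
        (extChartAt 𝓘(ℝ, V') (f x)).symm (chartMap V V' f x z) ∧
      (realDeriv V V' f ((extChartAt 𝓘(ℝ, V) x).symm z)).comp (chartInvDerivReal x z) =
        (chartInvDerivReal (f x) (chartMap V V' f x z)).comp (fderiv ℝ (chartMap V V' f x) z) := by
  have := IsManifold.real_of_complex (V := V) (X := X)
  have := IsManifold.real_of_complex (V := V') (X := Y)
  filter_upwards [hf.real_of_complex.eventually_mfderiv_extChartAt_symm x,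
    eventually_extChartAt_symm_writtenInExtChartAt (𝕜 := ℝ) (V := V) (V' := V')
      hf.continuous x] with z h1 h2
  refine ⟨h2.symm, ?_⟩
  ext v
  exact h1 v

/-- The pullback of a differential form. -/
def pullbackForm (f : X → Y) {k : ℕ} (η : Y → V' [⋀^Fin k]→L[ℝ] ℂ) (x : X) :
    V [⋀^Fin k]→L[ℝ] ℂ :=
  (η (f x)).compContinuousLinearMap (realDeriv V V' f x)

theorem formInChart_pullbackForm (hf : ContMDiff 𝓘(ℂ, V) 𝓘(ℂ, V') ω f) {k : ℕ}
    (η : Y → V' [⋀^Fin k]→L[ℝ] ℂ) (x : X) :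
    formInChart (pullbackForm (V := V) f η) x =ᶠ[𝓝 (extChartAt 𝓘(ℝ, V) x x)] fun z =>
      (formInChart η (f x) (chartMap V V' f x z)).compContinuousLinearMap
        (fderiv ℝ (chartMap V V' f x) z) := by
  filter_upwards [eventually_realDeriv_comp hf x] with z hz
  have : formInChart (pullbackForm (V := V) f η) x z =
      (η (f ((extChartAt 𝓘(ℝ, V) x).symm z))).compContinuousLinearMap
        ((realDeriv V V' f ((extChartAt 𝓘(ℝ, V) x).symm z)).comp (chartInvDerivReal x z)) := rfl
  rw [this, hz.1, hz.2]
  rfl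

theorem IsSmoothForm.pullbackForm (hf : ContMDiff 𝓘(ℂ, V) 𝓘(ℂ, V') ω f) {k : ℕ}
    {η : Y → V' [⋀^Fin k]→L[ℝ] ℂ} (hη : IsSmoothForm η) :
    IsSmoothForm (pullbackForm (V := V) f η) := by
  intro x
  refine ContDiffAt.congr_of_eventuallyEq ?_ (formInChart_pullbackForm hf η x)
  refine ContDiffAt.continuousAlternatingMap_compContinuousLinearMap ?_
    (contDiffAt_fderiv_chartMap hf x)
  refine ContDiffAt.comp (g := formInChart η (f x)) _ ?_
    ((contDiffAt_chartMap hf x).of_le (by simp))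
  rw [chartMap_self]
  exact hη (f x)

/-- Naturality of `extDeriv` in charts. The linear map is the same one as in
`Connection.curvature_descend`, so that the exact form and the discriminant form can be compared. -/
theorem formDeriv_pullbackForm (hf : ContMDiff 𝓘(ℂ, V) 𝓘(ℂ, V') ω f) {k : ℕ}
    {η : Y → V' [⋀^Fin k]→L[ℝ] ℂ} (hη : IsSmoothForm η) (x : X) :
    formDeriv (pullbackForm (V := V) f η) x = (formDeriv η (f x)).compContinuousLinearMap
      (fderiv ℝ (chartMap V V' f x) (extChartAt 𝓘(ℝ, V) x x)) := by
  have h : DifferentiableAt ℝ (formInChart η (f x))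
      (chartMap V V' f x (extChartAt 𝓘(ℝ, V) x x)) := by
    rw [chartMap_self]
    exact (hη (f x)).differentiableAt (by simp)
  unfold formDeriv
  rw [(formInChart_pullbackForm hf η x).extDeriv_eq,
    extDeriv_pullback h (contDiffAt_chartMap hf x) (by simp), chartMap_self]

/-- The pullback of a 1-form with values in matrices. -/
def pullbackEndForm {r : ℕ} (f : X → Y)
    (a : Y → V' →L[ℝ] (EuclideanSpace ℂ (Fin r) →L[ℂ] EuclideanSpace ℂ (Fin r))) (x : X) :
    V →L[ℝ] (EuclideanSpace ℂ (Fin r) →L[ℂ] EuclideanSpace ℂ (Fin r)) :=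
  (a (f x)).comp (realDeriv V V' f x)

theorem endFormInChart_pullbackEndForm (hf : ContMDiff 𝓘(ℂ, V) 𝓘(ℂ, V') ω f) {r : ℕ}
    (a : Y → V' →L[ℝ] (EuclideanSpace ℂ (Fin r) →L[ℂ] EuclideanSpace ℂ (Fin r))) (x : X) :
    endFormInChart (pullbackEndForm (V := V) f a) x =ᶠ[𝓝 (extChartAt 𝓘(ℝ, V) x x)] fun z =>
      (endFormInChart a (f x) (chartMap V V' f x z)).comp (fderiv ℝ (chartMap V V' f x) z) := by
  filter_upwards [eventually_realDeriv_comp hf x] with z hz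
  have : endFormInChart (pullbackEndForm (V := V) f a) x z =
      (a (f ((extChartAt 𝓘(ℝ, V) x).symm z))).comp
        ((realDeriv V V' f ((extChartAt 𝓘(ℝ, V) x).symm z)).comp (chartInvDerivReal x z)) := rfl
  rw [this, hz.1, hz.2]
  rfl

theorem contDiffAt_endFormInChart_pullbackEndForm (hf : ContMDiff 𝓘(ℂ, V) 𝓘(ℂ, V') ω f) {r : ℕ}
    {a : Y → V' →L[ℝ] (EuclideanSpace ℂ (Fin r) →L[ℂ] EuclideanSpace ℂ (Fin r))} {x : X}
    (ha : ContDiffAt ℝ ∞ (endFormInChart a (f x)) (extChartAt 𝓘(ℝ, V') (f x) (f x))) :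
    ContDiffAt ℝ ∞ (endFormInChart (pullbackEndForm (V := V) f a) x)
      (extChartAt 𝓘(ℝ, V) x x) := by
  refine ContDiffAt.congr_of_eventuallyEq ?_ (endFormInChart_pullbackEndForm hf a x)
  refine ContDiffAt.clm_comp ?_ (contDiffAt_fderiv_chartMap hf x)
  refine ContDiffAt.comp (g := endFormInChart a (f x)) _ ?_
    ((contDiffAt_chartMap hf x).of_le (by simp))
  rwa [chartMap_self]

/-- The curvature expression `dA + A ∧ A` commutes with pullback. -/
theorem curvature_pullbackEndForm (hf : ContMDiff 𝓘(ℂ, V) 𝓘(ℂ, V') ω f) {r : ℕ}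
    {a : Y → V' →L[ℝ] (EuclideanSpace ℂ (Fin r) →L[ℂ] EuclideanSpace ℂ (Fin r))} {x : X}
    (ha : ContDiffAt ℝ ∞ (endFormInChart a (f x)) (extChartAt 𝓘(ℝ, V') (f x) (f x))) (u v : V)
    {A : V → V →L[ℝ] (EuclideanSpace ℂ (Fin r) →L[ℂ] EuclideanSpace ℂ (Fin r))}
    {B : V' → V' →L[ℝ] (EuclideanSpace ℂ (Fin r) →L[ℂ] EuclideanSpace ℂ (Fin r))}
    (hA : A = endFormInChart (pullbackEndForm (V := V) f a) x) (hB : B = endFormInChart a (f x))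
    {z : V} (hz : z = extChartAt 𝓘(ℝ, V) x x) {z' : V'} (hz' : z' = extChartAt 𝓘(ℝ, V') (f x) (f x))
    {L : V →L[ℝ] V'} (hL : L = fderiv ℝ (chartMap V V' f x) z) :
    fderiv ℝ A z u v - fderiv ℝ A z v u + (A z u * A z v - A z v * A z u) =
      fderiv ℝ B z' (L u) (L v) - fderiv ℝ B z' (L v) (L u) +
        (B z' (L u) * B z' (L v) - B z' (L v) * B z' (L u)) := by
  have hAe := endFormInChart_pullbackEndForm (V := V) hf a x
  have hzz : z' = chartMap V V' f x z := by rw [hz, hz', chartMap_self]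
  rw [← hA, ← hB, ← hz] at hAe
  have hAz : ∀ w, A z w = B z' (L w) := fun w => by
    rw [hAe.eq_of_nhds, hL, hzz]; rfl
  have hBd : DifferentiableAt ℝ B (chartMap V V' f x z) := by
    rw [← hzz, hB, hz']
    exact ha.differentiableAt (by simp)
  have hcd : ContDiffAt ℝ ω (chartMap V V' f x) z := hz ▸ contDiffAt_chartMap hf x
  have key := fderiv_sub_fderiv_of_eventuallyEq_comp hBd hcd hAe u v
  rw [← hzz, ← hL] at key
  exact congrArg₂ (· + ·) key (by rw [hAz, hAz])

end FormPullback

end Higgs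

theorem ContMDiffAt.mdifferentiableAt_real_of_complex {V : Type*} [NormedAddCommGroup V]
    [NormedSpace ℂ V] {X : Type*} [TopologicalSpace X] [ChartedSpace V X]
    {W : Type*} [NormedAddCommGroup W] [NormedSpace ℂ W] {n : WithTop ℕ∞} (hn : n ≠ 0)
    {f : X → W} {x : X} (hf : ContMDiffAt 𝓘(ℂ, V) 𝓘(ℂ, W) n f x) :
    MDifferentiableAt 𝓘(ℝ, V) 𝓘(ℝ, W) f x := by
  have h := contMDiffAt_iff.1 hf
  have h' : ContMDiffAt 𝓘(ℝ, V) 𝓘(ℝ, W) n f x := by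
    rw [contMDiffAt_iff]
    exact ⟨h.1, h.2.restrict_scalars ℝ⟩
  exact h'.mdifferentiableAt hn

namespace Higgs

/-! ### Connections on pullbacks along biholomorphic maps -/

section ConnectionPullback

variable {V : Type*} [NormedAddCommGroup V] [NormedSpace ℂ V]
  {X : Type*} [TopologicalSpace X] [ChartedSpace V X]
  {V' : Type*} [NormedAddCommGroup V'] [NormedSpace ℂ V']
  {Y : Type*} [TopologicalSpace Y] [ChartedSpace V' Y]
  {r : ℕ} {E : Y → Type*} [∀ x, AddCommMonoid (E x)] [∀ x, Module ℂ (E x)]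
  [∀ x, TopologicalSpace (E x)] [TopologicalSpace (TotalSpace (EuclideanSpace ℂ (Fin r)) E)]
  [FiberBundle (EuclideanSpace ℂ (Fin r)) E] [VectorBundle ℂ (EuclideanSpace ℂ (Fin r)) E]

theorem transition_pullback (f : C^ω⟮𝓘(ℂ, V), X; 𝓘(ℂ, V'), Y⟯) (b b' x : X)
    (hb : f x ∈ (trivializationAt (EuclideanSpace ℂ (Fin r)) E (f b)).baseSet)
    (hb' : f x ∈ (trivializationAt (EuclideanSpace ℂ (Fin r)) E (f b')).baseSet) :
    transition r ((f : X → Y) *ᵖ E) b' b x = transition r E (f b') (f b) (f x) := by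
  ext1 v
  change ((trivializationAt (EuclideanSpace ℂ (Fin r)) E (f b')).pullback f).coordChangeL ℂ
    ((trivializationAt (EuclideanSpace ℂ (Fin r)) E (f b)).pullback f) x v =
    (trivializationAt (EuclideanSpace ℂ (Fin r)) E (f b')).coordChangeL ℂ
      (trivializationAt (EuclideanSpace ℂ (Fin r)) E (f b)) (f x) v
  rw [Trivialization.coordChangeL_apply _ _ ⟨hb', hb⟩, Trivialization.coordChangeL_apply']
  exacts [rfl, ⟨hb', hb⟩]

theorem mdifferentiableAt_transition
    [ContMDiffVectorBundle ω (EuclideanSpace ℂ (Fin r)) E 𝓘(ℂ, V')] {b b' y : Y}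
    (hb : y ∈ (trivializationAt (EuclideanSpace ℂ (Fin r)) E b).baseSet)
    (hb' : y ∈ (trivializationAt (EuclideanSpace ℂ (Fin r)) E b').baseSet) :
    MDifferentiableAt 𝓘(ℝ, V') 𝓘(ℝ, EuclideanSpace ℂ (Fin r) →L[ℂ] EuclideanSpace ℂ (Fin r))
      (transition r E b' b) y :=
  (contMDiffAt_coordChangeL (n := ω) (IB := 𝓘(ℂ, V')) hb' hb).mdifferentiableAt_real_of_complex
    (by simp)

variable [IsManifold 𝓘(ℂ, V) ω X] [IsManifold 𝓘(ℂ, V') ω Y]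

/-- The connection on `E` induced by a connection on the pullback of `E` along `f`, if `f` has a
holomorphic right inverse `g`. -/
def Connection.descend [ContMDiffVectorBundle ω (EuclideanSpace ℂ (Fin r)) E 𝓘(ℂ, V')]
    (f : C^ω⟮𝓘(ℂ, V), X; 𝓘(ℂ, V'), Y⟯) {g : Y → X}
    (hg : ContMDiff 𝓘(ℂ, V') 𝓘(ℂ, V) ω g) (hfg : ∀ y, f (g y) = y)
    (D : Connection V r ((f : X → Y) *ᵖ E)) : Connection V' r E where
  -- The trivialization of the pullback at `g b` comes from that of `E` at `f (g b) = b`, so `E`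
  -- need not be identified with its double pullback.
  form b := pullbackEndForm g (D.form (g b))
  smooth b y hy := by
    refine contDiffAt_endFormInChart_pullbackEndForm hg (D.smooth (g b) (g y) ?_)
    change f (g y) ∈ (trivializationAt (EuclideanSpace ℂ (Fin r)) E (f (g b))).baseSet
    rwa [hfg, hfg]
  transform b b' y hb hb' v := by
    have hb1 : f (g y) ∈ (trivializationAt (EuclideanSpace ℂ (Fin r)) E (f (g b))).baseSet := by
      rwa [hfg, hfg]
    have hb2 : f (g y) ∈ (trivializationAt (EuclideanSpace ℂ (Fin r)) E (f (g b'))).baseSet := by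
      rwa [hfg, hfg]
    have hT : transition r ((f : X → Y) *ᵖ E) (g b') (g b) (g y) = transition r E b' b y := by
      rw [transition_pullback f _ _ _ hb1 hb2, hfg, hfg, hfg]
    -- Equality near `y`, not only at `y`, is required to differentiate the transition functions.
    have hev : transition r E b' b =ᶠ[𝓝 y]
        transition r ((f : X → Y) *ᵖ E) (g b') (g b) ∘ g := by
      filter_upwards [(trivializationAt (EuclideanSpace ℂ (Fin r)) E b).open_baseSet.mem_nhds hb,
        (trivializationAt (EuclideanSpace ℂ (Fin r)) E b').open_baseSet.mem_nhds hb']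
        with y' h1 h2
      rw [Function.comp_apply, transition_pullback f, hfg, hfg, hfg]
      · rwa [hfg, hfg]
      · rwa [hfg, hfg]
    have hd1 : MDifferentiableAt 𝓘(ℝ, V)
        𝓘(ℝ, EuclideanSpace ℂ (Fin r) →L[ℂ] EuclideanSpace ℂ (Fin r))
        (transition r ((f : X → Y) *ᵖ E) (g b') (g b)) (g y) :=
      mdifferentiableAt_transition (E := (f : X → Y) *ᵖ E) hb1 hb2
    have hd2 : MDifferentiableAt 𝓘(ℝ, V') 𝓘(ℝ, V) g y :=
      hg.real_of_complex.contMDiffAt.mdifferentiableAt (by simp)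
    have hmf := (hev.mfderiv_eq (I := 𝓘(ℝ, V'))
      (I' := 𝓘(ℝ, EuclideanSpace ℂ (Fin r) →L[ℂ] EuclideanSpace ℂ (Fin r)))).trans
      (mfderiv_comp y hd1 hd2)
    have h := D.transform (g b) (g b') (g y) hb1 hb2 (realDeriv V' V g y v)
    rw [hT] at h
    refine h.trans (congrArg₂ (· + ·) rfl ?_)
    exact (congrArg (fun T : V' →L[ℝ] (EuclideanSpace ℂ (Fin r) →L[ℂ]
      EuclideanSpace ℂ (Fin r)) => T v) hmf).symm

theorem Connection.curvature_descend
    [ContMDiffVectorBundle ω (EuclideanSpace ℂ (Fin r)) E 𝓘(ℂ, V')]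
    (f : C^ω⟮𝓘(ℂ, V), X; 𝓘(ℂ, V'), Y⟯) {g : Y → X}
    (hg : ContMDiff 𝓘(ℂ, V') 𝓘(ℂ, V) ω g) (hfg : ∀ y, f (g y) = y)
    (D : Connection V r ((f : X → Y) *ᵖ E)) (y : Y) (u v : V') :
    (D.descend f hg hfg).curvature y u v = D.curvature (g y)
      (fderiv ℝ (chartMap V' V g y) (extChartAt 𝓘(ℝ, V') y y) u)
      (fderiv ℝ (chartMap V' V g y) (extChartAt 𝓘(ℝ, V') y y) v) :=
  curvature_pullbackEndForm (a := D.form (g y)) hg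
    (D.smooth (g y) (g y) (mem_baseSet_trivializationAt _ _ _)) u v rfl rfl rfl rfl rfl

theorem DiscriminantVanishes.of_pullback
    [ContMDiffVectorBundle ω (EuclideanSpace ℂ (Fin r)) E 𝓘(ℂ, V')]
    (f : C^ω⟮𝓘(ℂ, V), X; 𝓘(ℂ, V'), Y⟯) {g : Y → X}
    (hg : ContMDiff 𝓘(ℂ, V') 𝓘(ℂ, V) ω g) (hfg : ∀ y, f (g y) = y)
    (h : DiscriminantVanishes V r ((f : X → Y) *ᵖ E)) : DiscriminantVanishes V' r E := by
  obtain ⟨D, η, hη, hD⟩ := h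
  refine ⟨D.descend f hg hfg, pullbackForm g η, hη.pullbackForm hg, fun y v => ?_⟩
  rw [formDeriv_pullbackForm hg hη, ContinuousAlternatingMap.compContinuousLinearMap_apply, hD]
  -- The discriminant form is a universal polynomial in the curvature, so it pulls back along with
  -- it.
  simp only [Connection.discriminantForm, Connection.chernFormTwo, Connection.chernFormOne,
    wedgeTwoTwo, Connection.curvature_descend, Function.comp_apply]

end ConnectionPullback

/-- Being a Higgs variety is invariant under biholomorphic maps. -/
theorem IsHiggsVariety.of_diffeomorph {V : Type*} [NormedAddCommGroup V] [NormedSpace ℂ V]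
    [FiniteDimensional ℂ V]
    {X : Type*} [TopologicalSpace X] [ChartedSpace V X] [IsManifold 𝓘(ℂ, V) ω X]
    {Y : Type*} [TopologicalSpace Y] [ChartedSpace V Y] [IsManifold 𝓘(ℂ, V) ω Y]
    (e : X ≃ₘ^ω⟮𝓘(ℂ, V), 𝓘(ℂ, V)⟯ Y) (hX : IsHiggsVariety V X) : IsHiggsVariety V Y := by
  -- The curve case depends only on the model space `V`, which `X` and `Y` share.
  refine hX.imp id fun hX r hr E _ _ _ _ _ _ _ φ hφ hss => ?_
  let f : C^ω⟮𝓘(ℂ, V), X; 𝓘(ℂ, V), Y⟯ := ⟨e, e.contMDiff⟩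
  refine DiscriminantVanishes.of_pullback f e.symm.contMDiff e.apply_symm_apply ?_
  refine hX r hr ((f : X → Y) *ᵖ E) (pullbackHiggs f φ) (hφ.pullback f) ?_
  intro C _ _ _ _ _ _ c
  exact IsSemistableOnCurve.pullback_pullback f c (hss C (f.comp c))

end Higgs

end

/-! ### The theorem for surfaces. -/

theorem mainTheorem9
    (X : Type*) [TopologicalSpace X] [ChartedSpace (EuclideanSpace ℂ (Fin 2)) X]
    (Y : Type*) [TopologicalSpace Y] [ChartedSpace (EuclideanSpace ℂ (Fin 2)) Y]
    (hX : Higgs.IsSmoothProjectiveVariety (EuclideanSpace ℂ (Fin 2)) X)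
    (hY : Higgs.IsSmoothProjectiveVariety (EuclideanSpace ℂ (Fin 2)) Y)
    (g : OpenPartialHomeomorph X Y)
    (hsource : Higgs.IsBigOpenInSurface g.source)
    (htarget : Higgs.IsBigOpenInSurface g.target)
    (hg : ContMDiffOn 𝓘(ℂ, EuclideanSpace ℂ (Fin 2)) 𝓘(ℂ, EuclideanSpace ℂ (Fin 2)) ω
      g g.source)
    (hg' : ContMDiffOn 𝓘(ℂ, EuclideanSpace ℂ (Fin 2)) 𝓘(ℂ, EuclideanSpace ℂ (Fin 2)) ω
      g.symm g.target) :
    Higgs.IsHiggsVariety (EuclideanSpace ℂ (Fin 2)) X ↔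
      Higgs.IsHiggsVariety (EuclideanSpace ℂ (Fin 2)) Y := by
  have := hX.isManifold
  have := hX.t2Space
  have := hX.compactSpace
  have := hY.isManifold
  have := hY.t2Space
  have := hY.compactSpace
  obtain ⟨e⟩ := exists_diffeomorph_of_finite_compl g hsource.2 htarget.2 hg hg'
  exact ⟨Higgs.IsHiggsVariety.of_diffeomorph e, Higgs.IsHiggsVariety.of_diffeomorph e.symm⟩
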